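/- **Theorem 1.3.** Let $\Gamma=(V,\sim)$ be a $\mathbb{Z}^d$-periodic graph, that is, a locally finite graph with a faithful action of $G=\mathbb{Z}^d$ by graph automorphisms that has finitely many orbits. Suppose that $\Gamma$ is connected and has one crossing edge per generator: there is a set $F\subset V$ containing exactly one vertex of every orbit, such that there are exactly $2d$ adjacent pairs $u\sim v$ with $u\in F$ and $v\in V\setminus F$. Fix such an $F$ and put $N=|F|$. Let $H=(H_{u,v})_{u,v\in V}$ be a periodic real-symmetric operator on $\Gamma$, acting by $(Hf)_u=\sum_{v\in V}H_{u,v}f_v$: here $H_{u,v}=H_{v,u}\in\mathbb{R}$, $H_{gu,gv}=H_{u,v}$ for all $g\in G$, and for $u\ne v$ one has $H_{u,v}\neq0$ if and only if $u\sim v$ (the diagonal entries $H_{u,u}$ are arbitrary). Let $g_1,\dots,g_d$ be generators of $G$, let $\chi_\alpha$, for $\alpha\in\mathbb{T}^d=(\mathbb{R}/2\pi\mathbb{Z})^d$, be the character of $G$ with $\chi_\alpha(g_j)=e^{i\alpha_j}$ for all $j$, and let $$T(\alpha)=\Big(\sum_{g\in G}H_{u,gv}\,\chi_\alpha(g)\Big)_{u,v\in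 F},\qquad \alpha\in\mathbb{T}^d,$$ which is a Hermitian $N\times N$ matrix. For $1\le n\le N$ let $\lambda(\alpha)=\lambda_n(T(\alpha))$ be the $n$-th smallest eigenvalue of $T(\alpha)$, counted with multiplicity. Suppose that $\lambda$ has a local extremum at $\alpha^\circ\in\mathbb{T}^d$, that $\lambda(\alpha^\circ)$ is a simple eigenvalue of $T(\alpha^\circ)$, and that a corresponding eigenvector $f^\circ$ is non-zero on at least one end of every crossing edge: whenever $u,v\in F$ and $g\in G$ are such that $gv\notin F$ and $u\sim gv$, then $f^\circ_u\ne0$ or $f^\circ_v\neq 0$. Then, in each of the following cases, the local extremum is global, i.e. if $\alpha^\circ$ is a local minimum of $\lambda$, then $\lambda(\alpha^\circ)\le\lambda(\alpha)$ for all $\alpha\in\mathbb{T}^d$, and if it is a local maximum, then $\lambda(\alpha)\le\lambda(\alpha^\circ)$ for all $\alpha\in\mathbb{T}^d$: 1. $\alpha^\circ\in\{0,\pi\}^d$; 2. $d\le2$; 3. $d=3$ and the extremum is non-degenerate, i.e. the Hessian matrix of $\lambda$ at $\alpha^\circ$ is invertible. -/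

import Mathlib

/-- A `ℤ^d`-periodic graph: a locally finite graph with a faithful, cofinite action of the free
abelian group `ℤ^d` (written additively, `g +ᵥ v`) by graph automorphisms. -/
structure IsPeriodicGraph (d : ℕ) {V : Type*} [AddAction (Fin d → ℤ) V]
    (Γ : SimpleGraph V) : Prop where
  locallyFinite : ∀ v : V, (Γ.neighborSet v).Finite
  adj_vadd_iff : ∀ (g : Fin d → ℤ) (u v : V), Γ.Adj (g +ᵥ u) (g +ᵥ v) ↔ Γ.Adj u v
  faithful : FaithfulVAdd (Fin d → ℤ) V
  cofinite : Finite (AddAction.orbitRel.Quotient (Fin d → ℤ) V)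

/-- `F` contains exactly one representative of each orbit of `ℤ^d`. (When there are finitely many
orbits such an `F` is finite, so that taking a `Finset` loses nothing.) -/
def IsFundamentalDomainFor (d : ℕ) {V : Type*} [AddAction (Fin d → ℤ) V] (F : Finset V) : Prop :=
  ∀ v : V, ∃! u : V, u ∈ F ∧ u ∈ AddAction.orbit (Fin d → ℤ) v

/-- The fundamental domain `F` exhibits `Γ` as a graph with one crossing edge per generator:
`Γ` is connected and there are exactly `2d` adjacent pairs `(u, v)` with `u ∈ F` and `v ∉ F`. -/
structure HasOneCrossingEdgePerGenerator (d : ℕ) {V : Type*} [AddAction (Fin d → ℤ) V]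
    (Γ : SimpleGraph V) (F : Finset V) : Prop where
  connected : Γ.Connected
  fundamental : IsFundamentalDomainFor d F
  crossing : {p : V × V | p.1 ∈ F ∧ p.2 ∉ F ∧ Γ.Adj p.1 p.2}.encard = 2 * d

/-- The matrix elements `H u v` of a periodic self-adjoint operator
`(H f)_u = ∑_{v ∼ u} H_{u,v} f_v` on `Γ`, where every vertex counts as adjacent to itself (so the
diagonal is unrestricted); off the diagonal `H u v` is non-zero exactly on the edges of `Γ`. -/
structure IsPeriodicSelfAdjoint (d : ℕ) {V : Type*} [AddAction (Fin d → ℤ) V]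
    (Γ : SimpleGraph V) (H : Matrix V V ℂ) : Prop where
  hermitian : H.IsHermitian
  periodic : ∀ (g : Fin d → ℤ) (u v : V), H (g +ᵥ u) (g +ᵥ v) = H u v
  ne_zero_iff : ∀ u v : V, u ≠ v → (H u v ≠ 0 ↔ Γ.Adj u v)

/-- The character `χ_α` of `ℤ^d` with `χ_α (g_j) = exp (i α_j)`, where `g_1, …, g_d` is the given
choice of generators (a `ℤ`-basis) of `ℤ^d`. -/
noncomputable def blochCharacter {d : ℕ} (b : Module.Basis (Fin d) ℤ (Fin d → ℤ))
    (α : Fin d → ℝ) (g : Fin d → ℤ) : ℂ :=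
  Complex.exp (Complex.I * ∑ j, (α j : ℂ) * (b.repr g j : ℂ))

/-- The Floquet–Bloch transformed operator
`(T(α) f)_u = ∑_{v ∈ F, g ∈ ℤ^d} H_{u, g v} χ_α(g) f_v`, as a matrix indexed by `F`. Only terms with
`g v` equal or adjacent to `u` are non-zero. The quasimomentum is a vector `α ∈ ℝ^d`; `T` is
`2π`-periodic in each coordinate, so this is a function on the torus `(ℝ / 2πℤ)^d`. -/
noncomputable def floquetBloch {d : ℕ} {V : Type*} [AddAction (Fin d → ℤ) V]
    (b : Module.Basis (Fin d) ℤ (Fin d → ℤ)) (F : Finset V) (H : Matrix V V ℂ)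
    (α : Fin d → ℝ) : Matrix F F ℂ :=
  Matrix.of fun u v => ∑ᶠ g : Fin d → ℤ, H u (g +ᵥ (v : V)) * blochCharacter b α g

theorem star_blochCharacter {d : ℕ} (b : Module.Basis (Fin d) ℤ (Fin d → ℤ))
    (α : Fin d → ℝ) (g : Fin d → ℤ) :
    star (blochCharacter b α g) = blochCharacter b α (-g) := by
  simp [blochCharacter, ← Complex.exp_conj]

theorem floquetBloch_isHermitian {d : ℕ} {V : Type*} [AddAction (Fin d → ℤ) V]
    {Γ : SimpleGraph V} {H : Matrix V V ℂ} (hH : IsPeriodicSelfAdjoint d Γ H)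
    (b : Module.Basis (Fin d) ℤ (Fin d → ℤ)) (F : Finset V) (α : Fin d → ℝ) :
    (floquetBloch b F H α).IsHermitian := by
  ext u v
  simp only [Matrix.conjTranspose_apply, floquetBloch, Matrix.of_apply]
  have h1 := (starAddEquiv : ℂ ≃+ ℂ).map_finsum
    (fun g : Fin d → ℤ => H v (g +ᵥ (u : V)) * blochCharacter b α g)
  simp only [starAddEquiv_apply] at h1
  rw [h1, ← finsum_comp_equiv (Equiv.neg (Fin d → ℤ))]
  refine finsum_congr fun g => ?_
  rw [Equiv.neg_apply, star_mul', star_blochCharacter, neg_neg, hH.hermitian.apply]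
  congr 1
  have := hH.periodic g (-g +ᵥ (u : V)) v
  rw [vadd_vadd, add_neg_cancel, zero_vadd] at this
  exact this.symm

open Classical in
/-- The branches `λ_n(α)` of the dispersion relation: the eigenvalues of `T(α)`, repeated according
to multiplicity, in increasing order. (The indices `n` start from `0`; Mathlib's `eigenvalues₀` is
in decreasing order.) -/
noncomputable def branch {d : ℕ} {V : Type*} [AddAction (Fin d → ℤ) V]
    {Γ : SimpleGraph V} {H : Matrix V V ℂ} (hH : IsPeriodicSelfAdjoint d Γ H)
    (b : Module.Basis (Fin d) ℤ (Fin d → ℤ)) (F : Finset V)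
    (n : Fin (Fintype.card F)) (α : Fin d → ℝ) : ℝ :=
  (floquetBloch_isHermitian hH b F α).eigenvalues₀ n.rev

/-- The Hessian matrix of second partial derivatives of `f` at `α`. -/
noncomputable def hessianMatrix {d : ℕ} (f : (Fin d → ℝ) → ℝ) (α : Fin d → ℝ) :
    Matrix (Fin d) (Fin d) ℝ :=
  Matrix.of fun i j => iteratedFDeriv ℝ 2 f α ![Pi.single i 1, Pi.single j 1]

/-- `α` represents a corner point of the torus, i.e. a point of `{0, π}^d` modulo `2π`. -/
def IsCornerPoint {d : ℕ} (α : Fin d → ℝ) : Prop :=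
  ∀ j, ∃ m : ℤ, α j = m * Real.pi

/-! Choose one orientation of each crossing edge. The `d` resulting translations generate `ℤ^d`, so
the phases `θ_j` of these edges are linear coordinates for the quasimomentum, and `T` becomes an
`edgePencil`: a fixed symmetric operator plus, for each phase, one term of rank at most two.

Let `f` be the eigenvector at the extremum `θ₀`, with eigenvalue `l`, and put `A = T(θ₀) - l`. The
first-order condition, tested in one phase at a time, says that the ratio `r_j` of the values of `f`
across each edge is real once the phase `e^{iθ₀_j}` is absorbed (`exists_real_ratio`). With this
`r`, the vectors `w_j` = `edgeVector` are orthogonal to `f`, hence `w_j = A p_j`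
(`exists_preimage_edgeVector`), and completing the square (`re_inner_edgePencil_eq`) gives an
identity valid for every `θ`, not only near `θ₀`: `⟨x, T(θ) x⟩ = l ‖x‖² + ⟨z, A z⟩ + W(y)`, where `z
= x + ∑ y_j p_j`. Here `y` is linear in `x` with coefficients depending on `θ`, whereas the
Hermitian form `W` (`reducedMatrix`) does not depend on `θ`. By minimax, `W ≥ 0` therefore forces a
global minimum (`le_of_reForm_reducedMatrix_nonneg`).

A local minimum yields only part of this. To second order, moving along a real direction probes `W`,
in suitable coordinates, on real vectors alone (`eventually_le_add_sq_mul`). Complex conjugation,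
which maps `T(θ)` to `T(-θ)`, closes the gap. At a corner `W` is real in those coordinates
(`IsTimeReversal.reducedMatrix_im_eq_zero`), so real vectors suffice. Elsewhere the conjugate
eigenvector at `-θ₀` yields a non-zero kernel vector of `W`
(`IsTimeReversal.reducedMatrix_mulVec_eq_zero`). A singular Hermitian form that is non-negative on
real vectors is non-negative in dimension at most two, and in dimension three if it is strictly
positive on non-zero real vectors, which is what non-degeneracy supplies. Maxima are minima of `-T`.
-/

open scoped InnerProductSpace ComplexConjugate Matrix
open Filter Topology Asymptotics

/-! ### Variational characterization of eigenvalues. -/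

section Minimax

variable {E : Type*} [NormedAddCommGroup E] [InnerProductSpace ℂ E]

/-- The variational characterization of the real number `l` as an eigenvalue of `T` which has at
most `m` eigenvalues strictly below it and at most `p` strictly above it, where
`m + p + 1 = dim E`. -/
structure IsMinimaxValue (T : E →ₗ[ℂ] E) (l : ℝ) (m p : ℕ) : Prop where
  -- Subspaces of codimension at most `m` are encoded as kernels of maps to `Fin m → ℂ`.
  -- Precomposing such a map with any endomorphism, invertible or not, is again such a map.
  le_of_form_ge : ∀ (μ : ℝ) (g : E →ₗ[ℂ] (Fin m → ℂ)),
    (∀ x, g x = 0 → μ * ‖x‖ ^ 2 ≤ (⟪x, T x⟫_ℂ).re) → μ ≤ l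
  le_of_form_le : ∀ (μ : ℝ) (g : E →ₗ[ℂ] (Fin p → ℂ)),
    (∀ x, g x = 0 → (⟪x, T x⟫_ℂ).re ≤ μ * ‖x‖ ^ 2) → l ≤ μ
  exists_form_ge : ∃ g : E →ₗ[ℂ] (Fin m → ℂ), ∀ x, g x = 0 →
    l * ‖x‖ ^ 2 ≤ (⟪x, T x⟫_ℂ).re ∧ ((⟪x, T x⟫_ℂ).re = l * ‖x‖ ^ 2 → T x = (l : ℂ) • x)
  exists_form_le : ∃ g : E →ₗ[ℂ] (Fin p → ℂ), ∀ x, g x = 0 →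
    (⟪x, T x⟫_ℂ).re ≤ l * ‖x‖ ^ 2 ∧ ((⟪x, T x⟫_ℂ).re = l * ‖x‖ ^ 2 → T x = (l : ℂ) • x)

/-- Negation exchanges the numbers of eigenvalues below and above; this reduces maxima to minima. -/
theorem IsMinimaxValue.neg {T : E →ₗ[ℂ] E} {l : ℝ} {m p : ℕ} (h : IsMinimaxValue T l m p) :
    IsMinimaxValue (-T) (-l) p m where
  le_of_form_ge μ g hg := by
    have := h.le_of_form_le (-μ) g fun x hx => by
      have := hg x hx
      simp only [LinearMap.neg_apply, inner_neg_right, Complex.neg_re] at this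
      linarith
    linarith
  le_of_form_le μ g hg := by
    have := h.le_of_form_ge (-μ) g fun x hx => by
      have := hg x hx
      simp only [LinearMap.neg_apply, inner_neg_right, Complex.neg_re] at this
      linarith
    linarith
  exists_form_ge := by
    obtain ⟨g, hg⟩ := h.exists_form_le
    refine ⟨g, fun x hx => ?_⟩
    obtain ⟨h1, h2⟩ := hg x hx
    simp only [LinearMap.neg_apply, inner_neg_right, Complex.neg_re]
    refine ⟨by linarith, fun h3 => ?_⟩
    rw [h2 (by linarith)]; simp
  exists_form_le := by
    obtain ⟨g, hg⟩ := h.exists_form_ge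
    refine ⟨g, fun x hx => ?_⟩
    obtain ⟨h1, h2⟩ := hg x hx
    simp only [LinearMap.neg_apply, inner_neg_right, Complex.neg_re]
    refine ⟨by linarith, fun h3 => ?_⟩
    rw [h2 (by linarith)]; simp

variable [FiniteDimensional ℂ E] {T : E →ₗ[ℂ] E} (hT : T.IsSymmetric)
  {N : ℕ} (hN : Module.finrank ℂ E = N)

include hT in
theorem LinearMap.IsSymmetric.inner_eigenvectorBasis_apply (x : E) (i : Fin N) :
    ⟪hT.eigenvectorBasis hN i, T x⟫_ℂ =
      (hT.eigenvalues hN i : ℂ) * ⟪hT.eigenvectorBasis hN i, x⟫_ℂ := by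
  rw [← hT, hT.apply_eigenvectorBasis, inner_smul_left]
  simp

theorem LinearMap.IsSymmetric.re_inner_apply_self_eq_sum (x : E) :
    (⟪x, T x⟫_ℂ).re =
      ∑ i, hT.eigenvalues hN i * ‖⟪hT.eigenvectorBasis hN i, x⟫_ℂ‖ ^ 2 := by
  rw [← (hT.eigenvectorBasis hN).sum_inner_mul_inner x (T x), Complex.re_sum]
  refine Finset.sum_congr rfl fun i _ => ?_
  rw [hT.inner_eigenvectorBasis_apply hN, ← inner_conj_symm x, mul_left_comm,
    mul_comm ((starRingEnd ℂ) _), Complex.mul_conj, Complex.normSq_eq_norm_sq]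
  norm_cast

theorem LinearMap.IsSymmetric.re_inner_sub_eq_sum (l : ℝ) (x : E) :
    (⟪x, T x⟫_ℂ).re - l * ‖x‖ ^ 2 =
      ∑ i, (hT.eigenvalues hN i - l) * ‖⟪hT.eigenvectorBasis hN i, x⟫_ℂ‖ ^ 2 := by
  rw [hT.re_inner_apply_self_eq_sum hN, ← (hT.eigenvectorBasis hN).sum_sq_norm_inner_right x,
    Finset.mul_sum, ← Finset.sum_sub_distrib]
  simp only [sub_mul]

/-- The linear map recording the coefficients of a vector along eigenvectors listed by `s`. -/
noncomputable def LinearMap.IsSymmetric.coeffs {k : ℕ} (s : Fin k → Fin N) :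
    E →ₗ[ℂ] (Fin k → ℂ) :=
  LinearMap.pi fun i => (innerₛₗ ℂ (hT.eigenvectorBasis hN (s i)))

/-- Fewer than `N` linear conditions on an `N`-dimensional space have a common non-zero solution. -/
theorem LinearMap.IsSymmetric.exists_ne_zero_of_coeffs {j k : ℕ} (hjk : j + k < N)
    (s : Fin j → Fin N) (g : E →ₗ[ℂ] (Fin k → ℂ)) :
    ∃ x : E, x ≠ 0 ∧ g x = 0 ∧ ∀ i, ⟪hT.eigenvectorBasis hN (s i), x⟫_ℂ = 0 := by
  have : LinearMap.ker ((hT.coeffs hN s).prod g) ≠ ⊥ := by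
    apply LinearMap.ker_ne_bot_of_finrank_lt
    simpa [hN] using hjk
  obtain ⟨x, hx, hx0⟩ := Submodule.exists_mem_ne_zero_of_ne_bot this
  have hx' : (hT.coeffs hN s x, g x) = 0 := hx
  rw [Prod.mk_eq_zero] at hx'
  exact ⟨x, hx0, hx'.2, fun i => congrFun hx'.1 i⟩

theorem LinearMap.IsSymmetric.apply_eq_smul_of_forall {l : ℝ} {x : E}
    (h : ∀ i, (hT.eigenvalues hN i - l) * ‖⟪hT.eigenvectorBasis hN i, x⟫_ℂ‖ ^ 2 = 0) :
    T x = (l : ℂ) • x := by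
  refine InnerProductSpace.ext_inner_left_basis (hT.eigenvectorBasis hN).toBasis fun i => ?_
  rw [OrthonormalBasis.coe_toBasis, hT.inner_eigenvectorBasis_apply hN, inner_smul_right]
  rcases mul_eq_zero.1 (h i) with h | h
  · rw [sub_eq_zero.1 h]
  · rw [norm_eq_zero.1 (pow_eq_zero_iff two_ne_zero |>.1 h)]; simp

theorem LinearMap.IsSymmetric.isMinimaxValue_eigenvalues (k : Fin N) :
    IsMinimaxValue T (hT.eigenvalues hN k) (N - 1 - k) k := by
  have hk := k.2
  -- `hT.eigenvalues` is decreasing, so `s` lists the eigenvectors before position `k` (eigenvalues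
  -- at least the `k`-th) and `t` those after it (at most the `k`-th).
  let s : Fin k → Fin N := fun i => ⟨i, by omega⟩
  let t : Fin (N - 1 - k) → Fin N := fun i => ⟨k + 1 + i, by omega⟩
  have hs : ∀ x, (∀ i, ⟪hT.eigenvectorBasis hN (s i), x⟫_ℂ = 0) → ∀ i,
      (hT.eigenvalues hN i - hT.eigenvalues hN k) *
        ‖⟪hT.eigenvectorBasis hN i, x⟫_ℂ‖ ^ 2 ≤ 0 := by
    intro x hx i
    by_cases hi : i < k
    · have := hx ⟨i, hi⟩
      simp only [s, Fin.eta] at this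
      simp [this]
    · exact mul_nonpos_of_nonpos_of_nonneg
        (sub_nonpos.2 (hT.eigenvalues_antitone hN (not_lt.1 hi))) (sq_nonneg _)
  have ht : ∀ x, (∀ i, ⟪hT.eigenvectorBasis hN (t i), x⟫_ℂ = 0) → ∀ i,
      0 ≤ (hT.eigenvalues hN i - hT.eigenvalues hN k) *
        ‖⟪hT.eigenvectorBasis hN i, x⟫_ℂ‖ ^ 2 := by
    intro x hx i
    by_cases hi : k < i
    · have h1 : (k : ℕ) < i := hi
      have := hx ⟨i - (k + 1), by omega⟩
      have h2 : t ⟨i - (k + 1), by omega⟩ = i := by ext; simp only [t]; omega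
      rw [h2] at this
      simp [this]
    · exact mul_nonneg
        (sub_nonneg.2 (hT.eigenvalues_antitone hN (not_lt.1 hi))) (sq_nonneg _)
  refine ⟨fun μ g hg => ?_, fun μ g hg => ?_, ⟨hT.coeffs hN t, fun x hx => ?_⟩,
    ⟨hT.coeffs hN s, fun x hx => ?_⟩⟩
  · obtain ⟨x, hx0, hgx, hx⟩ := hT.exists_ne_zero_of_coeffs hN (by omega) s g
    have h1 := hg x hgx
    have h2 := hT.re_inner_sub_eq_sum hN (hT.eigenvalues hN k) x
    have h3 := Finset.sum_nonpos fun i (_ : i ∈ Finset.univ) => hs x hx i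
    have h4 : 0 < ‖x‖ ^ 2 := by positivity
    exact le_of_mul_le_mul_right (by linarith) h4
  · obtain ⟨x, hx0, hgx, hx⟩ := hT.exists_ne_zero_of_coeffs hN (by omega) t g
    have h1 := hg x hgx
    have h2 := hT.re_inner_sub_eq_sum hN (hT.eigenvalues hN k) x
    have h3 := Finset.sum_nonneg fun i (_ : i ∈ Finset.univ) => ht x hx i
    have h4 : 0 < ‖x‖ ^ 2 := by positivity
    exact le_of_mul_le_mul_right (by linarith) h4
  · have h2 := hT.re_inner_sub_eq_sum hN (hT.eigenvalues hN k) x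
    have hx' := ht x fun i => congrFun hx i
    have h3 := Finset.sum_nonneg fun i (_ : i ∈ Finset.univ) => hx' i
    refine ⟨by linarith, fun h => hT.apply_eq_smul_of_forall hN fun i => ?_⟩
    rw [h, sub_self, eq_comm, Finset.sum_eq_zero_iff_of_nonneg fun i _ => hx' i] at h2
    exact h2 i (Finset.mem_univ _)
  · have h2 := hT.re_inner_sub_eq_sum hN (hT.eigenvalues hN k) x
    have hx' := hs x fun i => congrFun hx i
    have h3 := Finset.sum_nonpos fun i (_ : i ∈ Finset.univ) => hx' i
    refine ⟨by linarith, fun h => hT.apply_eq_smul_of_forall hN fun i => ?_⟩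
    rw [h, sub_self, eq_comm, Finset.sum_eq_zero_iff_of_nonpos fun i _ => hx' i] at h2
    exact h2 i (Finset.mem_univ _)

end Minimax

/-! ### Hermitian forms that are non-negative on real vectors. -/

namespace Matrix.IsHermitian

variable {J : Type*} [Fintype J] {W : Matrix J J ℂ}

/-- The real quadratic form `re (y* W y)`. -/
noncomputable def _root_.Matrix.reForm (W : Matrix J J ℂ) (y : J → ℂ) : ℝ :=
  (star y ⬝ᵥ (W *ᵥ y)).re

theorem reForm_add (hW : W.IsHermitian) (x y : J → ℂ) :
    W.reForm (x + y) = W.reForm x + W.reForm y + 2 * (star x ⬝ᵥ (W *ᵥ y)).re := by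
  have h : (star y ⬝ᵥ (W *ᵥ x)).re = (star x ⬝ᵥ (W *ᵥ y)).re := by
    rw [← Complex.conj_re (star x ⬝ᵥ (W *ᵥ y))]
    congr 1
    change _ = star _
    rw [← star_dotProduct_star, star_star, star_mulVec, hW.eq, ← dotProduct_mulVec]
  simp only [Matrix.reForm, star_add, mulVec_add, add_dotProduct, dotProduct_add, Complex.add_re]
  rw [h]; ring

theorem _root_.Matrix.reForm_smul (W : Matrix J J ℂ) (c : ℂ) (x : J → ℂ) :
    W.reForm (c • x) = ‖c‖ ^ 2 * W.reForm x := by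
  simp only [Matrix.reForm, star_smul, mulVec_smul, smul_dotProduct, dotProduct_smul, smul_eq_mul]
  rw [← mul_assoc, Complex.star_def, Complex.mul_conj,
    Complex.normSq_eq_norm_sq, Complex.re_ofReal_mul]

/-- The forms at `z` and at its complex conjugate add up to those at the real and imaginary
parts of `z`. -/
theorem reForm_add_reForm_star (hW : W.IsHermitian) (z : J → ℂ) :
    W.reForm z + W.reForm (star z) =
      2 * (W.reForm (fun j => ((z j).re : ℂ)) + W.reForm (fun j => ((z j).im : ℂ))) := by
  set a : J → ℂ := fun j => ((z j).re : ℂ)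
  set b : J → ℂ := fun j => ((z j).im : ℂ)
  have h1 : z = a + Complex.I • b := by
    ext j; simp [a, b, mul_comm Complex.I, Complex.re_add_im]
  have h2 : star z = a + (-Complex.I) • b := by
    ext j; apply Complex.ext <;> simp [a, b]
  rw [h2]
  nth_rw 1 [h1]
  rw [hW.reForm_add, hW.reForm_add, reForm_smul, reForm_smul, mulVec_smul, mulVec_smul,
    dotProduct_smul, dotProduct_smul]
  simp
  ring

/-- If `W` is entrywise real and non-negative on real vectors, it is non-negative. -/
theorem reForm_nonneg_of_real (hW : W.IsHermitian) (hreal : ∀ i j, (W i j).im = 0)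
    (hpos : ∀ t : J → ℝ, 0 ≤ W.reForm fun j => (t j : ℂ)) (y : J → ℂ) : 0 ≤ W.reForm y := by
  have h1 : W.reForm (star y) = W.reForm y := by
    have : ∀ i j, conj (W i j) = W i j := fun i j => Complex.conj_eq_iff_im.2 (hreal i j)
    unfold Matrix.reForm
    rw [← Complex.conj_re]
    congr 1
    simp [dotProduct, mulVec, map_sum, this]
  have h2 := hW.reForm_add_reForm_star y
  rw [h1] at h2
  have := hpos fun j => (y j).re
  have := hpos fun j => (y j).im
  linarith

/-- A kernel vector `y` lies in the radical of the form. Hence, if the form is negative at `x`, it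
is non-positive on the whole span of `x` and `y`. -/
theorem reForm_smul_add_smul_of_mulVec_eq_zero (hW : W.IsHermitian) {x y : J → ℂ}
    (hy : W *ᵥ y = 0) (a b : ℂ) : W.reForm (a • x + b • y) = ‖a‖ ^ 2 * W.reForm x := by
  rw [hW.reForm_add, reForm_smul, reForm_smul, mulVec_smul, hy]
  simp [Matrix.reForm, hy]

theorem linearIndependent_of_reForm_neg {x y : J → ℂ} (hx : W.reForm x < 0) (hy0 : y ≠ 0)
    (hy : W *ᵥ y = 0) : LinearIndependent ℂ ![x, y] := by
  rw [LinearIndependent.pair_symm_iff, LinearIndependent.pair_iff' hy0]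
  rintro a rfl
  rw [reForm_smul] at hx
  simp [Matrix.reForm, hy] at hx

theorem finrank_span_pair_of_reForm_neg {x y : J → ℂ} (hx : W.reForm x < 0) (hy0 : y ≠ 0)
    (hy : W *ᵥ y = 0) : Module.finrank ℂ (Submodule.span ℂ {x, y}) = 2 := by
  have := finrank_span_eq_card (linearIndependent_of_reForm_neg hx hy0 hy)
  have h : Set.range ![x, y] = {x, y} := by
    ext z; simp [eq_comm, or_comm]
  rwa [h, Fintype.card_fin] at this

/-- A Hermitian matrix of size at most two that is singular and non-negative on real vectors is
non-negative. -/
theorem reForm_nonneg_of_card_le_two (hW : W.IsHermitian) (hJ : Fintype.card J ≤ 2)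
    (hpos : ∀ t : J → ℝ, 0 ≤ W.reForm fun j => (t j : ℂ)) {y : J → ℂ} (hy0 : y ≠ 0)
    (hy : W *ᵥ y = 0) (x : J → ℂ) : 0 ≤ W.reForm x := by
  by_contra! hx
  -- In dimension at most two this plane is everything, so it contains `star x`. The forms at `x`
  -- and `star x` then add up to something negative, against positivity on the real and imaginary
  -- parts.
  have htop : Submodule.span ℂ {x, y} = ⊤ := by
    apply Submodule.eq_top_of_finrank_eq
    refine le_antisymm (Submodule.finrank_le _) ?_
    rw [finrank_span_pair_of_reForm_neg hx hy0 hy]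
    simpa using hJ
  obtain ⟨a, b, hab⟩ := Submodule.mem_span_pair.1 (htop ▸ Submodule.mem_top : star x ∈ _)
  have h1 := hW.reForm_add_reForm_star x
  rw [← hab, hW.reForm_smul_add_smul_of_mulVec_eq_zero hy] at h1
  have := hpos fun j => (x j).re
  have := hpos fun j => (x j).im
  nlinarith [sq_nonneg ‖a‖]

/-- A Hermitian matrix of size at most three that is singular and positive on non-zero real
vectors is non-negative. -/
theorem reForm_nonneg_of_card_le_three (hW : W.IsHermitian) (hJ : Fintype.card J ≤ 3)
    (hpos : ∀ t : J → ℝ, t ≠ 0 → 0 < W.reForm fun j => (t j : ℂ)) {y : J → ℂ} (hy0 : y ≠ 0)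
    (hy : W *ᵥ y = 0) (x : J → ℂ) : 0 ≤ W.reForm x := by
  by_contra! hx
  have hpos' : ∀ t : J → ℝ, 0 ≤ W.reForm fun j => (t j : ℂ) := fun t => by
    by_cases ht : t = 0
    · simp [ht, Matrix.reForm, dotProduct]
    · exact (hpos t ht).le
  -- `K` need not contain `star x` now, but it meets its own conjugate: `B` sends `z` to `star z`
  -- modulo `K`, from real dimension four to real dimension at most two. A non-zero `z` in its
  -- kernel has both `z` and `star z` in `K`, where the form is non-positive.
  let K := Submodule.span ℂ {x, y}
  let A : (J → ℂ) →ₗ[ℂ] (J → ℂ) ⧸ K := K.mkQ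
  let B : K →ₗ[ℝ] (J → ℂ) ⧸ K :=
    (A.restrictScalars ℝ).comp
      ((LinearMap.pi fun j => (Complex.conjAe.toLinearMap).comp (LinearMap.proj j)).comp
        (K.subtype.restrictScalars ℝ))
  have hK := finrank_span_pair_of_reForm_neg hx hy0 hy
  have hlt : Module.finrank ℝ ((J → ℂ) ⧸ K) < Module.finrank ℝ K := by
    rw [← Module.finrank_mul_finrank ℝ ℂ K, ← Module.finrank_mul_finrank ℝ ℂ ((J → ℂ) ⧸ K),
      Submodule.finrank_quotient]
    simp only [K, hK, Complex.finrank_real_complex, Module.finrank_fintype_fun_eq_card]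
    omega
  obtain ⟨⟨z, hz⟩, hzB, hz0⟩ := Submodule.exists_mem_ne_zero_of_ne_bot
    (LinearMap.ker_ne_bot_of_finrank_lt (f := B) hlt)
  have hzs : star z ∈ K := by
    have h : A (star z) = 0 := hzB
    simpa [A] using h
  have hz0 : z ≠ 0 := fun h => hz0 (by simp [h])
  obtain ⟨a, b, hab⟩ := Submodule.mem_span_pair.1 hz
  obtain ⟨a', b', hab'⟩ := Submodule.mem_span_pair.1 hzs
  have h1 := hW.reForm_add_reForm_star z
  rw [← hab', hW.reForm_smul_add_smul_of_mulVec_eq_zero hy] at h1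
  nth_rw 1 [← hab] at h1
  rw [hW.reForm_smul_add_smul_of_mulVec_eq_zero hy] at h1
  have h2 := hpos' fun j => (z j).re
  have h3 := hpos' fun j => (z j).im
  have h4 : 0 < W.reForm (fun j => ((z j).re : ℂ)) + W.reForm (fun j => ((z j).im : ℂ)) := by
    by_cases hre : (fun j => (z j).re) = 0
    · have him : (fun j => (z j).im) ≠ 0 := fun him => hz0 <| by
        ext j; exact Complex.ext (congrFun hre j) (congrFun him j)
      linarith [hpos _ him]
    · linarith [hpos _ hre]
  nlinarith [sq_nonneg ‖a‖, sq_nonneg ‖a'‖]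

end Matrix.IsHermitian

/-! ### Perturbation of quadratic forms, uniformly on the unit sphere. -/

section Compactness

variable {E : Type*} [NormedAddCommGroup E] [InnerProductSpace ℂ E] [FiniteDimensional ℂ E]

/-- Upper bound for a perturbed quadratic form on the subspace where the unperturbed form `A` is
non-positive: to leading order only the value `ρ` of the perturbation on the kernel of `A`
matters. -/
theorem eventually_form_add_le {K : Type*} [AddCommGroup K] [Module ℂ K] [TopologicalSpace K]
    [T1Space K] [IsTopologicalAddGroup K] [ContinuousSMul ℂ K]
    {A : E →ₗ[ℂ] E} {g : E →ₗ[ℂ] K} {f : E} (hf : ‖f‖ = 1)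
    (hg : ∀ z, g z = 0 → (⟪z, A z⟫_ℂ).re ≤ 0 ∧ ((⟪z, A z⟫_ℂ).re = 0 → A z = 0))
    (hker : ∀ z, A z = 0 → ∃ c : ℂ, z = c • f)
    {Z : ℝ → E → E} (hZ : ∀ x, Tendsto (fun q : ℝ × E => Z q.1 q.2) (𝓝[>] 0 ×ˢ 𝓝 x) (𝓝 x))
    {R : ℝ → E → ℝ} {R₀ : E → ℝ}
    (hR : ∀ x, Tendsto (fun q : ℝ × E => R q.1 q.2) (𝓝[>] 0 ×ˢ 𝓝 x) (𝓝 (R₀ x)))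
    {ρ : ℝ} (hρ : ∀ c : ℂ, ‖c‖ = 1 → R₀ (c • f) = ρ)
    {s : ℝ → ℝ} (hs : ∀ t, 0 < t → 0 < s t) (hs0 : Tendsto s (𝓝[>] 0) (𝓝 0))
    {ε : ℝ} (hε : 0 < ε) :
    ∀ᶠ t in 𝓝[>] (0 : ℝ), ∀ x, ‖x‖ = 1 → g (Z t x) = 0 →
      (⟪Z t x, A (Z t x)⟫_ℂ).re + s t * R t x ≤ s t * (ρ + ε) := by
  have : ProperSpace E := FiniteDimensional.proper ℂ E
  have hAc : Continuous A := A.continuous_of_finiteDimensional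
  have hgc : Continuous g := g.continuous_of_finiteDimensional
  have hform : Continuous fun z : E => (⟪z, A z⟫_ℂ).re :=
    Complex.continuous_re.comp (continuous_id.inner hAc)
  -- Near each unit vector one of three things happens: the form of `A` is negative and beats the
  -- small perturbation; the vector is a unit multiple of `f`, where the perturbation is close to
  -- `ρ`; or `g x ≠ 0` and the constraint fails nearby. Compactness of the sphere makes this
  -- uniform.
  have key : ∀ x ∈ Metric.sphere (0 : E) 1, ∀ᶠ q : ℝ × E in 𝓝[>] 0 ×ˢ 𝓝 x,
      g (Z q.1 q.2) = 0 →
        (⟪Z q.1 q.2, A (Z q.1 q.2)⟫_ℂ).re + s q.1 * R q.1 q.2 ≤ s q.1 * (ρ + ε) := by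
    intro x hx
    have hx1 : ‖x‖ = 1 := by simpa using hx
    have hpos : ∀ᶠ q : ℝ × E in 𝓝[>] 0 ×ˢ 𝓝 x, 0 < s q.1 :=
      (tendsto_fst.eventually self_mem_nhdsWithin).mono fun q hq => hs _ hq
    by_cases hgx : g x = 0
    · rcases (hg x hgx).1.lt_or_eq with hneg | hzero
      · have h1 : Tendsto (fun q : ℝ × E => (⟪Z q.1 q.2, A (Z q.1 q.2)⟫_ℂ).re
            + s q.1 * (R q.1 q.2 - (ρ + ε))) (𝓝[>] 0 ×ˢ 𝓝 x)
            (𝓝 ((⟪x, A x⟫_ℂ).re + 0 * (R₀ x - (ρ + ε)))) :=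
          ((hform.tendsto x).comp (hZ x)).add
            ((hs0.comp tendsto_fst).mul ((hR x).sub tendsto_const_nhds))
        filter_upwards [h1.eventually_lt_const (by simpa using hneg)] with q hq _
        linarith
      · obtain ⟨c, rfl⟩ := hker x ((hg x hgx).2 hzero)
        have hc : ‖c‖ = 1 := by simpa [norm_smul, hf] using hx1
        have h1 := hR (c • f)
        rw [hρ c hc] at h1
        filter_upwards [hpos, h1.eventually_lt_const (lt_add_of_pos_right ρ hε)] with q hq hq' hgq
        have := (hg _ hgq).1
        have := mul_le_mul_of_nonneg_left hq'.le hq.le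
        linarith
    · have h1 : Tendsto (fun q : ℝ × E => g (Z q.1 q.2)) (𝓝[>] 0 ×ˢ 𝓝 x) (𝓝 (g x)) :=
        (hgc.tendsto x).comp (hZ x)
      filter_upwards [h1.eventually_ne hgx] with q hq hq'
      exact absurd hq' hq
  have := (isCompact_sphere (0 : E) 1).induction_on
    (p := fun B => ∀ᶠ t in 𝓝[>] (0 : ℝ), ∀ x ∈ B, g (Z t x) = 0 →
      (⟪Z t x, A (Z t x)⟫_ℂ).re + s t * R t x ≤ s t * (ρ + ε)) (by simp)
    (fun B B' hB h => h.mono fun t ht x hx => ht x (hB hx))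
    (fun B B' hB hB' => by
      filter_upwards [hB, hB'] with t h1 h2 x hx
      exact hx.elim (h1 x) (h2 x))
    (fun x hx => by
      obtain ⟨pa, hpa, pb, hpb, h⟩ := eventually_prod_iff.1 (key x hx)
      exact ⟨_, mem_nhdsWithin_of_mem_nhds hpb, hpa.mono fun t ht x hx => h ht hx⟩)
  filter_upwards [this] with t ht x hx
  exact ht x (by simpa using hx)

end Compactness

/-! ### Operators depending on independent edge phases. -/

section EdgePencil

variable {E : Type*} [NormedAddCommGroup E] [InnerProductSpace ℂ E]
  {J : Type*} [Fintype J]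

/-- The operator `S + ∑ j, h j (e^{iθ_j} |a_j⟩⟨b_j| + e^{-iθ_j} |b_j⟩⟨a_j|)`. -/
noncomputable def edgePencil (S : E →ₗ[ℂ] E) (h : J → ℝ) (a b : J → E) (θ : J → ℝ) :
    E →ₗ[ℂ] E :=
  S + ∑ j, (h j : ℂ) •
    (Complex.exp (θ j * Complex.I) • (innerₛₗ ℂ (b j)).smulRight (a j) +
      Complex.exp (-(θ j * Complex.I)) • (innerₛₗ ℂ (a j)).smulRight (b j))

variable (S : E →ₗ[ℂ] E) (h : J → ℝ) (a b : J → E) (θ θ₀ : J → ℝ)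

theorem edgePencil_apply (x : E) :
    edgePencil S h a b θ x = S x + ∑ j, (h j : ℂ) •
      ((Complex.exp (θ j * Complex.I) * ⟪b j, x⟫_ℂ) • a j +
        (Complex.exp (-(θ j * Complex.I)) * ⟪a j, x⟫_ℂ) • b j) := by
  simp [edgePencil, LinearMap.sum_apply, smul_smul, mul_assoc]

theorem neg_edgePencil :
    -edgePencil S h a b θ = edgePencil (-S) (fun j => -h j) a b θ := by
  simp only [edgePencil, neg_add, ← Finset.sum_neg_distrib, Complex.ofReal_neg, neg_smul]

theorem conj_exp_mul_I (t : ℝ) :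
    conj (Complex.exp (t * Complex.I)) = Complex.exp (-(t * Complex.I)) := by
  rw [← Complex.exp_conj]; simp

theorem conj_exp_neg_mul_I (t : ℝ) :
    conj (Complex.exp (-(t * Complex.I))) = Complex.exp (t * Complex.I) := by
  rw [← Complex.exp_conj]; simp

theorem exp_neg_mul_exp_mul_I (t : ℝ) :
    Complex.exp (-(t * Complex.I)) * Complex.exp (t * Complex.I) = 1 := by
  rw [← Complex.exp_add, neg_add_cancel, Complex.exp_zero]

theorem exp_mul_exp_neg_mul_I (t : ℝ) :
    Complex.exp (t * Complex.I) * Complex.exp (-(t * Complex.I)) = 1 := by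
  rw [← Complex.exp_add, add_neg_cancel, Complex.exp_zero]

theorem re_inner_edgePencil (x : E) :
    (⟪x, edgePencil S h a b θ x⟫_ℂ).re = (⟪x, S x⟫_ℂ).re +
      ∑ j, 2 * h j * (Complex.exp (θ j * Complex.I) * conj ⟪a j, x⟫_ℂ * ⟪b j, x⟫_ℂ).re := by
  rw [edgePencil_apply, inner_add_right, inner_sum, Complex.add_re, Complex.re_sum]
  congr 1
  refine Finset.sum_congr rfl fun j _ => ?_
  rw [inner_smul_right, inner_add_right, inner_smul_right, inner_smul_right,
    ← inner_conj_symm x (a j), ← inner_conj_symm x (b j), Complex.re_ofReal_mul, Complex.add_re]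
  have h1 : (Complex.exp (-(θ j * Complex.I)) * ⟪a j, x⟫_ℂ * conj ⟪b j, x⟫_ℂ).re =
      (Complex.exp (θ j * Complex.I) * conj ⟪a j, x⟫_ℂ * ⟪b j, x⟫_ℂ).re := by
    rw [← Complex.conj_re]
    simp [conj_exp_neg_mul_I]
  rw [h1, mul_right_comm (Complex.exp _) ⟪b j, x⟫_ℂ]
  ring

/-- The coefficient by which the `j`-th edge differs between quasimomenta `θ` and `θ₀`. -/
noncomputable def edgeCoeff (j : J) : ℂ :=
  h j * (Complex.exp (-(θ j * Complex.I)) - Complex.exp (-(θ₀ j * Complex.I)))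

/-- Vectors which are orthogonal to the reference eigenvector when `r` records the ratio of its
values at the two ends of each edge. -/
noncomputable def edgeVector (r : J → ℝ) (j : J) : E :=
  b j - ((r j : ℂ) * Complex.exp (θ₀ j * Complex.I)) • a j

omit [Fintype J] in
theorem inner_edgeVector (r : J → ℝ) (j : J) (x : E) :
    ⟪edgeVector a b θ₀ r j, x⟫_ℂ =
      ⟪b j, x⟫_ℂ - r j * Complex.exp (-(θ₀ j * Complex.I)) * ⟪a j, x⟫_ℂ := by
  rw [edgeVector, inner_sub_left, inner_smul_left, map_mul, conj_exp_mul_I, Complex.conj_ofReal]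

/-- The difference of two edge forms, expressed so that the dependence on the quasimomentum is
carried by a single complex number `y` per edge. -/
theorem edge_form_sub {h r t t₀ : ℝ} (hh : h ≠ 0) (A B : ℂ) :
    let y : ℂ := h * (Complex.exp (-(t * Complex.I)) - Complex.exp (-(t₀ * Complex.I))) * A
    2 * h * (Complex.exp (t * Complex.I) * conj A * B).re
        - 2 * h * (Complex.exp (t₀ * Complex.I) * conj A * B).re =
      2 * (conj y * (B - r * Complex.exp (-(t₀ * Complex.I)) * A)).re + (-r / h) * ‖y‖ ^ 2 := by
  intro y
  set e := Complex.exp (t * Complex.I) with he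
  set e₀ := Complex.exp (t₀ * Complex.I) with he₀
  have c1 : Complex.exp (-(t * Complex.I)) = conj e := (conj_exp_mul_I t).symm
  have c2 : Complex.exp (-(t₀ * Complex.I)) = conj e₀ := (conj_exp_mul_I t₀).symm
  have hy : conj y = h * (e - e₀) * conj A := by simp [y, c1, c2]
  have n1 : e.re * e.re + e.im * e.im = 1 := by
    rw [← Complex.normSq_apply, Complex.normSq_eq_norm_sq, he, Complex.norm_exp_ofReal_mul_I]
    norm_num
  have n2 : e₀.re * e₀.re + e₀.im * e₀.im = 1 := by
    rw [← Complex.normSq_apply, Complex.normSq_eq_norm_sq, he₀, Complex.norm_exp_ofReal_mul_I]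
    norm_num
  have hny : ‖y‖ ^ 2 = h ^ 2 * ((e.re - e₀.re) ^ 2 + (e.im - e₀.im) ^ 2)
      * (A.re ^ 2 + A.im ^ 2) := by
    rw [← Complex.normSq_eq_norm_sq, ← Complex.normSq_conj, hy]
    simp only [Complex.normSq_mul, Complex.normSq_ofReal, Complex.normSq_conj]
    simp only [Complex.normSq_apply, Complex.sub_re, Complex.sub_im]
    ring
  rw [hny, hy, c2]
  have : -r / h * (h ^ 2 * ((e.re - e₀.re) ^ 2 + (e.im - e₀.im) ^ 2) * (A.re ^ 2 + A.im ^ 2)) =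
      -r * h * (((e.re - e₀.re) ^ 2 + (e.im - e₀.im) ^ 2) * (A.re ^ 2 + A.im ^ 2)) := by
    field_simp
  rw [this]
  simp only [Complex.mul_re, Complex.mul_im, Complex.sub_re, Complex.sub_im, Complex.conj_re,
    Complex.conj_im, Complex.ofReal_re, Complex.ofReal_im]
  linear_combination (r * h * (A.re ^ 2 + A.im ^ 2)) * (n1 - n2)

theorem re_inner_edgePencil_sub {r : J → ℝ} (hh : ∀ j, h j ≠ 0) (x : E) :
    (⟪x, edgePencil S h a b θ x⟫_ℂ).re = (⟪x, edgePencil S h a b θ₀ x⟫_ℂ).re +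
      ∑ j, (2 * (conj (edgeCoeff h θ θ₀ j * ⟪a j, x⟫_ℂ) * ⟪edgeVector a b θ₀ r j, x⟫_ℂ).re +
        (-r j / h j) * ‖edgeCoeff h θ θ₀ j * ⟪a j, x⟫_ℂ‖ ^ 2) := by
  rw [re_inner_edgePencil, re_inner_edgePencil, add_assoc, ← Finset.sum_add_distrib]
  congr 1
  refine Finset.sum_congr rfl fun j _ => ?_
  rw [inner_edgeVector, edgeCoeff, ← edge_form_sub (hh j)]
  ring

end EdgePencil

/-! ### The reduced form and completion of the square. -/

section ReducedMatrix

variable {E : Type*} [NormedAddCommGroup E] [InnerProductSpace ℂ E]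
  {J : Type*} [Fintype J]

open Classical in
/-- The matrix `ω - p* A p` of the reduced quadratic form. -/
noncomputable def reducedMatrix (A : E →ₗ[ℂ] E) (ω : J → ℝ) (p : J → E) : Matrix J J ℂ :=
  Matrix.diagonal (fun j => (ω j : ℂ)) - Matrix.of fun j k => ⟪p j, A (p k)⟫_ℂ

omit [Fintype J] in
theorem reducedMatrix_isHermitian {A : E →ₗ[ℂ] E} (hA : A.IsSymmetric) (ω : J → ℝ) (p : J → E) :
    (reducedMatrix A ω p).IsHermitian := by
  classical
  refine Matrix.IsHermitian.sub ?_ ?_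
  · exact Matrix.isHermitian_diagonal_iff.2 fun j => by simp [IsSelfAdjoint]
  · ext j k
    simp [hA (p j) (p k)]

theorem reducedMatrix_mulVec (A : E →ₗ[ℂ] E) (ω : J → ℝ) (p : J → E) (y : J → ℂ) (j : J) :
    (reducedMatrix A ω p *ᵥ y) j = ω j * y j - ⟪p j, A (∑ k, y k • p k)⟫_ℂ := by
  classical
  simp only [reducedMatrix, Matrix.sub_mulVec, Pi.sub_apply, Matrix.mulVec_diagonal, map_sum,
    map_smul, inner_sum, inner_smul_right]
  congr 1
  simp [Matrix.mulVec, dotProduct, mul_comm]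

theorem reForm_reducedMatrix (A : E →ₗ[ℂ] E) (ω : J → ℝ) (p : J → E) (y : J → ℂ) :
    (reducedMatrix A ω p).reForm y =
      ∑ j, ω j * ‖y j‖ ^ 2 - (⟪∑ k, y k • p k, A (∑ k, y k • p k)⟫_ℂ).re := by
  simp only [Matrix.reForm, dotProduct, reducedMatrix_mulVec, mul_sub, Finset.sum_sub_distrib,
    Complex.sub_re, Complex.re_sum]
  congr 1
  · refine Finset.sum_congr rfl fun j _ => ?_
    rw [mul_left_comm, Pi.star_apply, Complex.star_def, mul_comm (conj _), Complex.mul_conj,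
      Complex.normSq_eq_norm_sq]
    norm_cast
  · rw [sum_inner, Complex.re_sum]
    simp only [inner_smul_left, Pi.star_apply, Complex.star_def]

/-- Completing the square in the quadratic form of the pencil. -/
theorem re_inner_edgePencil_eq (S : E →ₗ[ℂ] E) {h : J → ℝ} (a b : J → E) (θ θ₀ : J → ℝ)
    {r : J → ℝ} (hh : ∀ j, h j ≠ 0) {l : ℝ} {A : E →ₗ[ℂ] E} (hA : A.IsSymmetric)
    (hAl : ∀ x, A x = edgePencil S h a b θ₀ x - (l : ℂ) • x)
    {p : J → E} (hp : ∀ j, A (p j) = edgeVector a b θ₀ r j) (x : E) :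
    (⟪x, edgePencil S h a b θ x⟫_ℂ).re = l * ‖x‖ ^ 2 +
      (⟪x + ∑ j, (edgeCoeff h θ θ₀ j * ⟪a j, x⟫_ℂ) • p j,
        A (x + ∑ j, (edgeCoeff h θ θ₀ j * ⟪a j, x⟫_ℂ) • p j)⟫_ℂ).re +
      (reducedMatrix A (fun j => -r j / h j) p).reForm
        fun j => edgeCoeff h θ θ₀ j * ⟪a j, x⟫_ℂ := by
  set y : J → ℂ := fun j => edgeCoeff h θ θ₀ j * ⟪a j, x⟫_ℂ with hy
  rw [re_inner_edgePencil_sub S h a b θ θ₀ (r := r) hh, reForm_reducedMatrix]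
  set P := ∑ k, y k • p k with hP
  have h1 : (⟪x + P, A (x + P)⟫_ℂ).re =
      (⟪x, A x⟫_ℂ).re + 2 * (⟪P, A x⟫_ℂ).re + (⟪P, A P⟫_ℂ).re := by
    have : (⟪x, A P⟫_ℂ).re = (⟪P, A x⟫_ℂ).re := by
      rw [← hA P x, ← inner_conj_symm, Complex.conj_re]
    simp only [map_add, inner_add_left, inner_add_right, Complex.add_re, this]
    ring
  -- Since `A (p j)` is the edge vector, the cross term of the square reproduces the linear part of
  -- the edge forms; the surplus `⟨P, A P⟩` is what the reduced matrix subtracts.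
  have h2 : (⟪P, A x⟫_ℂ).re = ∑ j, (conj (y j) * ⟪edgeVector a b θ₀ r j, x⟫_ℂ).re := by
    rw [hP, sum_inner, Complex.re_sum]
    refine Finset.sum_congr rfl fun j _ => ?_
    rw [inner_smul_left, ← hA, hp]
  have h3 : (⟪x, A x⟫_ℂ).re = (⟪x, edgePencil S h a b θ₀ x⟫_ℂ).re - l * ‖x‖ ^ 2 := by
    rw [hAl, inner_sub_right, inner_smul_right, Complex.sub_re, Complex.re_ofReal_mul,
      inner_self_eq_norm_sq_to_K]
    norm_cast
  simp only [h1, h2, h3, Finset.sum_add_distrib, ← Finset.mul_sum]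
  ring

end ReducedMatrix

/-! ### Size of the edge coefficients and the shift that completes the square. -/

section Core

variable {E : Type*} [NormedAddCommGroup E] [InnerProductSpace ℂ E]
  {J : Type*} [Fintype J]

theorem form_le_of_forall_norm_eq_one {K : Type*} [AddCommGroup K] [Module ℂ K]
    {T : E →ₗ[ℂ] E} {g : E →ₗ[ℂ] K} {μ : ℝ}
    (hu : ∀ x, ‖x‖ = 1 → g x = 0 → (⟪x, T x⟫_ℂ).re ≤ μ) (x : E) (hx : g x = 0) :
    (⟪x, T x⟫_ℂ).re ≤ μ * ‖x‖ ^ 2 := by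
  by_cases h0 : x = 0
  · simp [h0]
  have hn : ‖x‖ ≠ 0 := norm_ne_zero_iff.2 h0
  have h1 := hu (((‖x‖⁻¹ : ℝ) : ℂ) • x) (by simp [norm_smul, hn]) (by simp [hx])
  rw [map_smul, inner_smul_left, inner_smul_right, Complex.conj_ofReal, Complex.re_ofReal_mul,
    Complex.re_ofReal_mul, ← mul_assoc, ← mul_inv, ← sq, inv_mul_le_iff₀ (by positivity)] at h1
  linarith

theorem Matrix.reForm_le (W : Matrix J J ℂ) {y : J → ℂ} {M : ℝ} (hy : ∀ j, ‖y j‖ ≤ M) :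
    W.reForm y ≤ (∑ j, ∑ k, ‖W j k‖) * M ^ 2 := by
  rw [Matrix.reForm]
  refine (Complex.re_le_norm _).trans ?_
  simp only [dotProduct, mulVec, Finset.mul_sum, Finset.sum_mul]
  refine (norm_sum_le _ _).trans (Finset.sum_le_sum fun j _ => ?_)
  refine (norm_sum_le _ _).trans (Finset.sum_le_sum fun k _ => ?_)
  rw [norm_mul, norm_mul, Pi.star_apply, norm_star]
  have hM : 0 ≤ M := (norm_nonneg _).trans (hy j)
  calc ‖y j‖ * (‖W j k‖ * ‖y k‖) ≤ M * (‖W j k‖ * M) := by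
        gcongr <;> apply hy
    _ = _ := by ring

theorem Matrix.continuous_reForm (W : Matrix J J ℂ) : Continuous W.reForm := by
  unfold Matrix.reForm
  fun_prop

/-- From `|e^{is} - 1| ≤ |s|`; it makes the reduced form quadratically small near `θ₀`. -/
theorem norm_edgeCoeff_le (h : J → ℝ) (θ θ₀ : J → ℝ) (j : J) :
    ‖edgeCoeff h θ θ₀ j‖ ≤ ‖h‖ * ‖θ - θ₀‖ := by
  have h1 : Complex.exp (-(θ j * Complex.I)) - Complex.exp (-(θ₀ j * Complex.I)) =
      Complex.exp (-(θ₀ j * Complex.I)) *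
        (Complex.exp (Complex.I * ((-(θ j - θ₀ j) : ℝ) : ℂ)) - 1) := by
    rw [mul_sub, ← Complex.exp_add, mul_one]
    congr 2
    push_cast; ring
  have h2 : ‖Complex.exp (-(θ₀ j * Complex.I))‖ = 1 := by
    rw [← conj_exp_mul_I, RCLike.norm_conj, Complex.norm_exp_ofReal_mul_I]
  rw [edgeCoeff, h1, norm_mul, norm_mul, h2, one_mul, Complex.norm_real]
  refine mul_le_mul (norm_le_pi_norm h j) ?_ (norm_nonneg _) (norm_nonneg _)
  refine (Real.norm_exp_I_mul_ofReal_sub_one_le).trans ?_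
  rw [norm_neg]
  exact norm_le_pi_norm (θ - θ₀) j

-- The velocity along `δ` is a fixed complex factor times the real number `δ j`. This is why the
-- second-order expansion sees the reduced form only on real vectors, up to a diagonal change of
-- coordinates.
omit [Fintype J] in
theorem tendsto_edgeCoeff_div (h : J → ℝ) (θ₀ δ : J → ℝ) (j : J) :
    Tendsto (fun t : ℝ => edgeCoeff h (θ₀ + t • δ) θ₀ j / t) (𝓝[>] 0)
      (𝓝 (-Complex.I * h j * Complex.exp (-(θ₀ j * Complex.I)) * δ j)) := by
  have h1 : HasDerivAt (fun t : ℝ => (h j : ℂ) * Complex.exp (-(((θ₀ j + t * δ j : ℝ) : ℂ) *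
      Complex.I))) (-Complex.I * h j * Complex.exp (-(θ₀ j * Complex.I)) * δ j) 0 := by
    have h2 : HasDerivAt (fun t : ℝ => -(((θ₀ j + t * δ j : ℝ) : ℂ) * Complex.I))
        (-((δ j : ℂ) * Complex.I)) 0 := by
      have h4 : HasDerivAt (fun t : ℝ => θ₀ j + t * δ j) (δ j) 0 := by
        simpa using ((hasDerivAt_id (0 : ℝ)).mul_const (δ j)).const_add (θ₀ j)
      exact (h4.ofReal_comp.mul_const _).fun_neg
    refine (h2.cexp.const_mul (h j : ℂ)).congr_deriv ?_
    rw [zero_mul, add_zero]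
    ring
  have h3 := h1.tendsto_slope_zero_right
  refine h3.congr fun t => ?_
  simp only [edgeCoeff, Pi.add_apply, Pi.smul_apply, smul_eq_mul, zero_add, zero_mul, add_zero,
    Complex.real_smul, Complex.ofReal_inv]
  rw [div_eq_inv_mul]
  ring

/-- The linear substitution that completes the square. -/
noncomputable def edgeShift (h : J → ℝ) (a p : J → E) (θ θ₀ : J → ℝ) : E →ₗ[ℂ] E :=
  LinearMap.id + ∑ j, edgeCoeff h θ θ₀ j • (innerₛₗ ℂ (a j)).smulRight (p j)

theorem edgeShift_apply (h : J → ℝ) (a p : J → E) (θ θ₀ : J → ℝ) (x : E) :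
    edgeShift h a p θ θ₀ x = x + ∑ j, (edgeCoeff h θ θ₀ j * ⟪a j, x⟫_ℂ) • p j := by
  simp [edgeShift, LinearMap.sum_apply, smul_smul]

end Core

/-! ### Consequences of an extremum to first and second order. -/

section Extremum

variable {E : Type*} [NormedAddCommGroup E] [InnerProductSpace ℂ E]
  {J : Type*} [Fintype J]

theorem re_inner_sub_smul {A T : E →ₗ[ℂ] E} {l : ℝ} (hAl : ∀ x, A x = T x - (l : ℂ) • x) (z : E) :
    (⟪z, A z⟫_ℂ).re = (⟪z, T z⟫_ℂ).re - l * ‖z‖ ^ 2 := by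
  rw [hAl, inner_sub_right, inner_smul_right, Complex.sub_re, Complex.re_ofReal_mul,
    inner_self_eq_norm_sq_to_K]
  norm_cast

theorem edgePencil_isSymmetric {S : E →ₗ[ℂ] E} (hS : S.IsSymmetric) (h : J → ℝ) (a b : J → E)
    (θ : J → ℝ) : (edgePencil S h a b θ).IsSymmetric := by
  intro x y
  rw [edgePencil_apply, edgePencil_apply, inner_add_left, inner_add_right, hS x y, sum_inner,
    inner_sum]
  congr 1
  refine Finset.sum_congr rfl fun j _ => ?_
  simp only [inner_smul_left, inner_smul_right, inner_add_left, inner_add_right, map_mul,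
    conj_exp_mul_I, conj_exp_neg_mul_I, Complex.conj_ofReal, inner_conj_symm]
  ring

variable {S : E →ₗ[ℂ] E} {h : J → ℝ} {a b : J → E} {θ₀ : J → ℝ}
  {L : (J → ℝ) → ℝ} {m q : ℕ} {f : E} {A : E →ₗ[ℂ] E} {r : J → ℝ} {p : J → E}

/-- If the reduced matrix is non-negative, the value at `θ₀` is a global minimum. -/
theorem le_of_reForm_reducedMatrix_nonneg (hh : ∀ j, h j ≠ 0)
    (hL : ∀ θ, IsMinimaxValue (edgePencil S h a b θ) (L θ) m q)
    (hA : A.IsSymmetric) (hAl : ∀ x, A x = edgePencil S h a b θ₀ x - (L θ₀ : ℂ) • x)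
    (hp : ∀ j, A (p j) = edgeVector a b θ₀ r j)
    (hW : ∀ y, 0 ≤ (reducedMatrix A (fun j => -r j / h j) p).reForm y) (θ : J → ℝ) :
    L θ₀ ≤ L θ := by
  obtain ⟨g, hg⟩ := (hL θ₀).exists_form_ge
  -- The constraint is imposed on the shifted vector, where the form of `A` is non-negative. It
  -- costs at most `m` conditions even if the shift is singular, so `θ` may be far from `θ₀`.
  refine (hL θ).le_of_form_ge _ (g ∘ₗ edgeShift h a p θ θ₀) fun x hx => ?_
  rw [re_inner_edgePencil_eq S a b θ θ₀ hh hA hAl hp, ← edgeShift_apply]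
  have h1 := (hg _ hx).1
  have h2 := hW fun j => edgeCoeff h θ θ₀ j * ⟪a j, x⟫_ℂ
  rw [re_inner_sub_smul hAl]
  linarith

/-- The form of `A` is non-positive where the upper coefficients vanish. -/
theorem exists_form_nonpos (hL : IsMinimaxValue (edgePencil S h a b θ₀) (L θ₀) m q)
    (hAl : ∀ x, A x = edgePencil S h a b θ₀ x - (L θ₀ : ℂ) • x) :
    ∃ g : E →ₗ[ℂ] (Fin q → ℂ), ∀ z, g z = 0 →
      (⟪z, A z⟫_ℂ).re ≤ 0 ∧ ((⟪z, A z⟫_ℂ).re = 0 → A z = 0) := by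
  obtain ⟨g, hg⟩ := hL.exists_form_le
  refine ⟨g, fun z hz => ?_⟩
  have h1 : (⟪z, A z⟫_ℂ).re = (⟪z, edgePencil S h a b θ₀ z⟫_ℂ).re - L θ₀ * ‖z‖ ^ 2 :=
    re_inner_sub_smul hAl z
  rw [h1]
  refine ⟨by linarith [(hg z hz).1], fun h2 => ?_⟩
  rw [hAl, (hg z hz).2 (by linarith), sub_self]

/-- Quadratic upper bound for the eigenvalue around a critical point. -/
theorem exists_le_add_mul_norm_sq (hh : ∀ j, h j ≠ 0)
    (hL : ∀ θ, IsMinimaxValue (edgePencil S h a b θ) (L θ) m q)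
    (hA : A.IsSymmetric) (hAl : ∀ x, A x = edgePencil S h a b θ₀ x - (L θ₀ : ℂ) • x)
    (hp : ∀ j, A (p j) = edgeVector a b θ₀ r j) :
    ∃ C, ∀ θ, L θ ≤ L θ₀ + C * ‖θ - θ₀‖ ^ 2 := by
  obtain ⟨g, hg⟩ := exists_form_nonpos (hL θ₀) hAl
  set W := reducedMatrix A (fun j => -r j / h j) p with hW
  let B := ∑ j, ‖a j‖
  refine ⟨(∑ j, ∑ k, ‖W j k‖) * (‖h‖ * B) ^ 2, fun θ => ?_⟩
  refine (hL θ).le_of_form_le _ (g ∘ₗ edgeShift h a p θ θ₀) fun x hx => ?_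
  rw [re_inner_edgePencil_eq S a b θ θ₀ hh hA hAl hp, ← edgeShift_apply]
  have h1 := (hg _ hx).1
  have h2 := W.reForm_le (y := fun j => edgeCoeff h θ θ₀ j * ⟪a j, x⟫_ℂ)
    (M := ‖h‖ * ‖θ - θ₀‖ * (B * ‖x‖)) fun j => by
      rw [norm_mul]
      have hB : ‖a j‖ ≤ B :=
        Finset.single_le_sum (f := fun j => ‖a j‖) (fun _ _ => norm_nonneg _) (Finset.mem_univ j)
      refine mul_le_mul (norm_edgeCoeff_le h θ θ₀ j) ?_ (norm_nonneg _) (by positivity)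
      exact (norm_inner_le_norm _ _).trans (by gcongr)
  rw [← hW]
  nlinarith [h1, h2]

variable [FiniteDimensional ℂ E]

omit [FiniteDimensional ℂ E] in
theorem tendsto_edgeShift (h : J → ℝ) (a p : J → E) (θ₀ δ : J → ℝ) (x : E) :
    Tendsto (fun u : ℝ × E => edgeShift h a p (θ₀ + u.1 • δ) θ₀ u.2) (𝓝[>] 0 ×ˢ 𝓝 x) (𝓝 x) := by
  have hc : Continuous fun u : ℝ × E => edgeShift h a p (θ₀ + u.1 • δ) θ₀ u.2 := by
    simp only [edgeShift_apply, edgeCoeff, Pi.add_apply, Pi.smul_apply, smul_eq_mul]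
    fun_prop
  have h1 := hc.tendsto ((0 : ℝ), x)
  have h2 : edgeShift h a p (θ₀ + (0 : ℝ) • δ) θ₀ x = x := by
    simp [edgeShift_apply, edgeCoeff]
  rw [nhds_prod_eq] at h1
  simp only [h2] at h1
  exact h1.mono_left (prod_mono_left _ nhdsWithin_le_nhds)

/-- Second-order upper bound for the eigenvalue along a line through a critical point. -/
theorem eventually_le_add_sq_mul (hh : ∀ j, h j ≠ 0)
    (hL : ∀ θ, IsMinimaxValue (edgePencil S h a b θ) (L θ) m q) (hf : ‖f‖ = 1)
    (hA : A.IsSymmetric) (hAl : ∀ x, A x = edgePencil S h a b θ₀ x - (L θ₀ : ℂ) • x)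
    (hker : ∀ z, A z = 0 → ∃ c : ℂ, z = c • f)
    (hp : ∀ j, A (p j) = edgeVector a b θ₀ r j) (δ : J → ℝ) {ε : ℝ} (hε : 0 < ε) :
    ∀ᶠ t in 𝓝[>] (0 : ℝ), L (θ₀ + t • δ) ≤ L θ₀ + t ^ 2 *
      ((reducedMatrix A (fun j => -r j / h j) p).reForm (fun j =>
        -Complex.I * h j * Complex.exp (-(θ₀ j * Complex.I)) * δ j * ⟪a j, f⟫_ℂ) + ε) := by
  obtain ⟨g, hg⟩ := exists_form_nonpos (hL θ₀) hAl
  set W := reducedMatrix A (fun j => -r j / h j) p with hW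
  set κ : J → ℂ := fun j => -Complex.I * h j * Complex.exp (-(θ₀ j * Complex.I)) * δ j with hκ
  have hR : ∀ x : E, Tendsto (fun u : ℝ × E => W.reForm fun j =>
      edgeCoeff h (θ₀ + u.1 • δ) θ₀ j / u.1 * ⟪a j, u.2⟫_ℂ) (𝓝[>] 0 ×ˢ 𝓝 x)
      (𝓝 (W.reForm fun j => κ j * ⟪a j, x⟫_ℂ)) := by
    intro x
    refine (W.continuous_reForm.tendsto _).comp (tendsto_pi_nhds.2 fun j => ?_)
    refine ((tendsto_edgeCoeff_div h θ₀ δ j).comp tendsto_fst).mul ?_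
    exact (Continuous.tendsto (by fun_prop) x).comp tendsto_snd
  have key := eventually_form_add_le hf hg hker
    (Z := fun t x => edgeShift h a p (θ₀ + t • δ) θ₀ x)
    (R := fun t x => W.reForm fun j => edgeCoeff h (θ₀ + t • δ) θ₀ j / t * ⟪a j, x⟫_ℂ)
    (R₀ := fun x => W.reForm fun j => κ j * ⟪a j, x⟫_ℂ)
    (ρ := W.reForm fun j => κ j * ⟪a j, f⟫_ℂ) (s := fun t => t ^ 2)
    (tendsto_edgeShift h a p θ₀ δ) hR ?_ (fun t ht => by positivity) ?_ hε
  · filter_upwards [key, self_mem_nhdsWithin] with t ht ht0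
    have ht0 : (0 : ℝ) < t := ht0
    refine (hL _).le_of_form_le _ (g ∘ₗ edgeShift h a p (θ₀ + t • δ) θ₀)
      (form_le_of_forall_norm_eq_one fun x hx hgx => ?_)
    have h1 := ht x hx hgx
    rw [re_inner_edgePencil_eq S a b _ θ₀ hh hA hAl hp, ← edgeShift_apply, hx, ← hW]
    -- Pulling out one factor `t` from `y` pulls out `t ^ 2` from the reduced form.
    have h2 : (fun j => edgeCoeff h (θ₀ + t • δ) θ₀ j * ⟪a j, x⟫_ℂ) =
        (t : ℂ) • fun j => edgeCoeff h (θ₀ + t • δ) θ₀ j / t * ⟪a j, x⟫_ℂ := by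
      have : (t : ℂ) ≠ 0 := by exact_mod_cast ht0.ne'
      ext j
      simp only [Pi.smul_apply, smul_eq_mul]
      field_simp
    rw [h2, W.reForm_smul, Complex.norm_real, Real.norm_eq_abs, sq_abs]
    linarith
  · intro c hc
    have : (fun j => κ j * ⟪a j, c • f⟫_ℂ) = c • fun j => κ j * ⟪a j, f⟫_ℂ := by
      ext j; simp; ring
    simp only [this, W.reForm_smul, hc]; simp
  · have : Tendsto (fun t : ℝ => t ^ 2) (𝓝 0) (𝓝 (0 ^ 2)) := (continuous_pow 2).tendsto 0
    simp only [ne_eq, OfNat.ofNat_ne_zero, not_false_eq_true, zero_pow] at this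
    exact this.mono_left nhdsWithin_le_nhds

omit [Fintype J] in
theorem nonneg_of_isLocalMin_of_eventually_le {δ : J → ℝ} (hmin : IsLocalMin L θ₀) {ρ : ℝ}
    {s : ℝ → ℝ} (hs : ∀ t, 0 < t → 0 < s t)
    (h : ∀ ε : ℝ, 0 < ε → ∀ᶠ t in 𝓝[>] (0 : ℝ), L (θ₀ + t • δ) ≤ L θ₀ + s t * (ρ + ε)) :
    0 ≤ ρ := by
  refine le_of_forall_pos_le_add fun ε hε => ?_
  have h1 : Tendsto (fun t : ℝ => θ₀ + t • δ) (𝓝[>] 0) (𝓝 θ₀) := by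
    have : Tendsto (fun t : ℝ => θ₀ + t • δ) (𝓝 0) (𝓝 (θ₀ + (0 : ℝ) • δ)) :=
      Continuous.tendsto (by fun_prop) 0
    rw [zero_smul, add_zero] at this
    exact this.mono_left nhdsWithin_le_nhds
  obtain ⟨t, ⟨h2, h3⟩, h4⟩ :=
    ((h1.eventually hmin).and (h ε hε) |>.and self_mem_nhdsWithin).exists
  have h5 := hs t h4
  have : 0 ≤ s t * (ρ + ε) := by linarith
  exact nonneg_of_mul_nonneg_right this h5

/-- First-order upper bound for the eigenvalue along a line. -/
theorem eventually_le_add_mul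
    (hL : ∀ θ, IsMinimaxValue (edgePencil S h a b θ) (L θ) m q) (hf : ‖f‖ = 1)
    (hAl : ∀ x, A x = edgePencil S h a b θ₀ x - (L θ₀ : ℂ) • x)
    (hker : ∀ z, A z = 0 → ∃ c : ℂ, z = c • f) (δ : J → ℝ) {ε : ℝ} (hε : 0 < ε) :
    ∀ᶠ t in 𝓝[>] (0 : ℝ), L (θ₀ + t • δ) ≤ L θ₀ + t *
      (∑ j, 2 * (conj (-Complex.I * h j * Complex.exp (-(θ₀ j * Complex.I)) * δ j) *
        conj ⟪a j, f⟫_ℂ * ⟪b j, f⟫_ℂ).re + ε) := by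
  obtain ⟨g, hg⟩ := exists_form_nonpos (hL θ₀) hAl
  set κ : J → ℂ := fun j => -Complex.I * h j * Complex.exp (-(θ₀ j * Complex.I)) * δ j with hκ
  have hR : ∀ x : E, Tendsto (fun u : ℝ × E => ∑ j, 2 *
      (conj (edgeCoeff h (θ₀ + u.1 • δ) θ₀ j / u.1) * conj ⟪a j, u.2⟫_ℂ * ⟪b j, u.2⟫_ℂ).re)
      (𝓝[>] 0 ×ˢ 𝓝 x) (𝓝 (∑ j, 2 * (conj (κ j) * conj ⟪a j, x⟫_ℂ * ⟪b j, x⟫_ℂ).re)) := by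
    intro x
    refine tendsto_finsetSum _ fun j _ => Tendsto.const_mul _ ?_
    refine (Complex.continuous_re.tendsto _).comp (Tendsto.mul (Tendsto.mul ?_ ?_) ?_)
    · exact (Complex.continuous_conj.tendsto _).comp
        ((tendsto_edgeCoeff_div h θ₀ δ j).comp tendsto_fst)
    · exact ((Complex.continuous_conj.comp (continuous_const.inner continuous_id)).tendsto x).comp
        tendsto_snd
    · exact ((continuous_const.inner continuous_id).tendsto x).comp tendsto_snd
  -- To first order no square has to be completed, so the constraint is left unshifted.
  have key := eventually_form_add_le hf hg hker
    (Z := fun t x => x)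
    (R := fun t x => ∑ j, 2 *
      (conj (edgeCoeff h (θ₀ + t • δ) θ₀ j / t) * conj ⟪a j, x⟫_ℂ * ⟪b j, x⟫_ℂ).re)
    (R₀ := fun x => ∑ j, 2 * (conj (κ j) * conj ⟪a j, x⟫_ℂ * ⟪b j, x⟫_ℂ).re)
    (ρ := ∑ j, 2 * (conj (κ j) * conj ⟪a j, f⟫_ℂ * ⟪b j, f⟫_ℂ).re) (s := fun t => t)
    (fun x => tendsto_snd) hR ?_ (fun t ht => ht) (tendsto_id.mono_left nhdsWithin_le_nhds) hε
  · filter_upwards [key, self_mem_nhdsWithin] with t ht ht0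
    have ht0 : (0 : ℝ) < t := ht0
    refine (hL _).le_of_form_le _ g (form_le_of_forall_norm_eq_one fun x hx hgx => ?_)
    have h1 := ht x hx hgx
    have h2 : (⟪x, A x⟫_ℂ).re = (⟪x, edgePencil S h a b θ₀ x⟫_ℂ).re - L θ₀ := by
      rw [re_inner_sub_smul hAl, hx]
      ring
    have h3 : (⟪x, edgePencil S h a b (θ₀ + t • δ) x⟫_ℂ).re =
        (⟪x, edgePencil S h a b θ₀ x⟫_ℂ).re + t * ∑ j, 2 *
      (conj (edgeCoeff h (θ₀ + t • δ) θ₀ j / t) * conj ⟪a j, x⟫_ℂ * ⟪b j, x⟫_ℂ).re := by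
      rw [re_inner_edgePencil, re_inner_edgePencil, add_assoc, Finset.mul_sum,
        ← Finset.sum_add_distrib]
      congr 1
      refine Finset.sum_congr rfl fun j _ => ?_
      have h4 : conj (edgeCoeff h (θ₀ + t • δ) θ₀ j / t) = ((h j / t : ℝ) : ℂ) *
          (Complex.exp (((θ₀ + t • δ) j : ℝ) * Complex.I) - Complex.exp (θ₀ j * Complex.I)) := by
        simp only [edgeCoeff, map_div₀, map_mul, map_sub, conj_exp_neg_mul_I, Complex.conj_ofReal,
          Complex.ofReal_div]
        ring
      rw [h4, mul_assoc (Complex.ofReal _), mul_assoc (Complex.ofReal _), Complex.re_ofReal_mul,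
        sub_mul, sub_mul, Complex.sub_re]
      field_simp
      ring
    linarith
  · intro c hc
    refine Finset.sum_congr rfl fun j _ => ?_
    have h1 : conj c * c = 1 := by
      rw [mul_comm, Complex.mul_conj, Complex.normSq_eq_norm_sq, hc]; simp
    rw [inner_smul_right, inner_smul_right, map_mul (starRingEnd ℂ) c]
    congr 2
    linear_combination conj (κ j) * conj ⟪a j, f⟫_ℂ * ⟪b j, f⟫_ℂ * h1

/-- At a local minimum the ratio of the eigenvector across every edge is real, once the
quasimomentum is taken into account. -/
theorem exists_real_ratio (hh : ∀ j, h j ≠ 0)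
    (hL : ∀ θ, IsMinimaxValue (edgePencil S h a b θ) (L θ) m q) (hf : ‖f‖ = 1)
    (hAl : ∀ x, A x = edgePencil S h a b θ₀ x - (L θ₀ : ℂ) • x)
    (hker : ∀ z, A z = 0 → ∃ c : ℂ, z = c • f) (haf : ∀ j, ⟪a j, f⟫_ℂ ≠ 0)
    (hmin : IsLocalMin L θ₀) :
    ∃ r : J → ℝ, ∀ j, Complex.exp (θ₀ j * Complex.I) * ⟪b j, f⟫_ℂ = r j * ⟪a j, f⟫_ℂ := by
  classical
  have key : ∀ j, (Complex.exp (θ₀ j * Complex.I) * ⟪b j, f⟫_ℂ * conj ⟪a j, f⟫_ℂ).im = 0 := by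
    intro j
    set w := Complex.exp (θ₀ j * Complex.I) * ⟪b j, f⟫_ℂ * conj ⟪a j, f⟫_ℂ with hw
    have hsum : ∀ s : ℝ, (∑ k, 2 * (conj (-Complex.I * h k * Complex.exp (-(θ₀ k * Complex.I)) *
        (Pi.single j s : J → ℝ) k) * conj ⟪a k, f⟫_ℂ * ⟪b k, f⟫_ℂ).re) = -(2 * s * h j * w.im) := by
      intro s
      rw [Finset.sum_eq_single j]
      · have : conj (-Complex.I * h j * Complex.exp (-(θ₀ j * Complex.I)) *
            (Pi.single j s : J → ℝ) j) * conj ⟪a j, f⟫_ℂ * ⟪b j, f⟫_ℂ =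
            ((h j * s : ℝ) : ℂ) * (Complex.I * w) := by
          simp only [map_mul, map_neg, Complex.conj_I, Complex.conj_ofReal, conj_exp_neg_mul_I,
            Pi.single_eq_same, hw]
          push_cast; ring
        rw [this, Complex.re_ofReal_mul, Complex.I_mul_re]
        ring
      · intro k _ hk
        simp [Pi.single_eq_of_ne hk]
      · simp
    -- The directional derivative along the `j`-th phase is linear in `s` and non-negative for both
    -- signs, hence zero.
    have hs : ∀ s : ℝ, 0 ≤ -(2 * s * h j * w.im) := fun s => by
      have := nonneg_of_isLocalMin_of_eventually_le hmin (s := fun t => t) (fun t ht => ht)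
        fun ε hε => eventually_le_add_mul hL hf hAl hker (Pi.single j s) hε
      rwa [hsum] at this
    have h1 := hs 1
    have h2 := hs (-1)
    have h3 : h j * w.im = 0 := by linarith
    exact (mul_eq_zero.1 h3).resolve_left (hh j)
  refine ⟨fun j => (Complex.exp (θ₀ j * Complex.I) * ⟪b j, f⟫_ℂ * conj ⟪a j, f⟫_ℂ).re /
    Complex.normSq ⟪a j, f⟫_ℂ, fun j => ?_⟩
  have h1 : ((Complex.exp (θ₀ j * Complex.I) * ⟪b j, f⟫_ℂ * conj ⟪a j, f⟫_ℂ).re : ℂ) =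
      Complex.exp (θ₀ j * Complex.I) * ⟪b j, f⟫_ℂ * conj ⟪a j, f⟫_ℂ :=
    Complex.ext rfl (key j).symm
  have h2 : (conj ⟪a j, f⟫_ℂ) ≠ 0 := (map_ne_zero _).2 (haf j)
  have h3 := haf j
  rw [Complex.ofReal_div, h1, ← Complex.mul_conj]
  field_simp

omit [Fintype J] in
/-- The edge vectors lie in the range of `A`. -/
theorem exists_preimage_edgeVector (hA : A.IsSymmetric)
    (hker : ∀ z, A z = 0 → ∃ c : ℂ, z = c • f)
    (hr : ∀ j, Complex.exp (θ₀ j * Complex.I) * ⟪b j, f⟫_ℂ = r j * ⟪a j, f⟫_ℂ) :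
    ∃ p : J → E, ∀ j, A (p j) = edgeVector a b θ₀ r j := by
  -- The kernel of `A` consists of multiples of `f`, and the choice of `r` makes every edge vector
  -- orthogonal to `f`.
  have h1 : LinearMap.range A = (LinearMap.ker A)ᗮ := by
    rw [← hA.orthogonal_range, Submodule.orthogonal_orthogonal]
  have h2 : ∀ j, edgeVector a b θ₀ r j ∈ LinearMap.range A := fun j => by
    rw [h1, Submodule.mem_orthogonal']
    intro z hz
    obtain ⟨c, rfl⟩ := hker z hz
    rw [inner_smul_right, inner_edgeVector]
    have h3 : ⟪b j, f⟫_ℂ = r j * Complex.exp (-(θ₀ j * Complex.I)) * ⟪a j, f⟫_ℂ := by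
      linear_combination Complex.exp (-(θ₀ j * Complex.I)) * hr j -
        ⟪b j, f⟫_ℂ * exp_neg_mul_exp_mul_I (θ₀ j)
    rw [h3, sub_self, mul_zero]
  choose p hp using h2
  exact ⟨p, hp⟩

end Extremum

/-! ### Complex conjugation and its effect on the reduced matrix. -/

section TimeReversal

variable {E : Type*} [NormedAddCommGroup E] [InnerProductSpace ℂ E]
  {J : Type*} [Fintype J]

/-- A complex conjugation under which the pencil is time-reversal symmetric. -/
structure IsTimeReversal (C : E →ₛₗ[starRingEnd ℂ] E) (S : E →ₗ[ℂ] E) (a b : J → E) : Prop where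
  inner_map_map : ∀ x y, ⟪C x, C y⟫_ℂ = conj ⟪x, y⟫_ℂ
  map_op : ∀ x, C (S x) = S (C x)
  map_left : ∀ j, C (a j) = a j
  map_right : ∀ j, C (b j) = b j

variable {C : E →ₛₗ[starRingEnd ℂ] E} {S : E →ₗ[ℂ] E} {h : J → ℝ} {a b : J → E} {θ₀ : J → ℝ}
  {l : ℝ} {f : E} {A : E →ₗ[ℂ] E} {r : J → ℝ} {p : J → E}

omit [Fintype J] in
theorem IsTimeReversal.neg (hC : IsTimeReversal C S a b) : IsTimeReversal C (-S) a b :=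
  ⟨hC.inner_map_map, fun x => by simp [hC.map_op], hC.map_left, hC.map_right⟩

omit [Fintype J] in
theorem IsTimeReversal.inner_left_map (hC : IsTimeReversal C S a b) (j : J) (x : E) :
    ⟪a j, C x⟫_ℂ = conj ⟪a j, x⟫_ℂ := by
  rw [← hC.inner_map_map, hC.map_left]

omit [Fintype J] in
theorem IsTimeReversal.inner_right_map (hC : IsTimeReversal C S a b) (j : J) (x : E) :
    ⟪b j, C x⟫_ℂ = conj ⟪b j, x⟫_ℂ := by
  rw [← hC.inner_map_map, hC.map_right]

theorem IsTimeReversal.map_edgePencil (hC : IsTimeReversal C S a b) (θ : J → ℝ) (x : E) :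
    C (edgePencil S h a b θ x) = edgePencil S h a b (-θ) (C x) := by
  rw [edgePencil_apply, edgePencil_apply, map_add, map_sum, hC.map_op]
  congr 1
  refine Finset.sum_congr rfl fun j _ => ?_
  simp only [map_add, LinearMap.map_smulₛₗ, map_mul, conj_exp_mul_I, conj_exp_neg_mul_I,
    Complex.conj_ofReal, hC.map_left, hC.map_right, hC.inner_left_map, hC.inner_right_map,
    Pi.neg_apply, Complex.ofReal_neg, neg_mul, neg_neg]

/-- Time-reversal symmetry produces a kernel vector of the reduced matrix. -/
theorem IsTimeReversal.reducedMatrix_mulVec_eq_zero (hC : IsTimeReversal C S a b)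
    (hh : ∀ j, h j ≠ 0) (hA : A.IsSymmetric)
    (hAl : ∀ x, A x = edgePencil S h a b θ₀ x - (l : ℂ) • x) (hAf : A f = 0)
    (hr : ∀ j, Complex.exp (θ₀ j * Complex.I) * ⟪b j, f⟫_ℂ = r j * ⟪a j, f⟫_ℂ)
    (hp : ∀ j, A (p j) = edgeVector a b θ₀ r j) :
    (reducedMatrix A (fun j => -r j / h j) p) *ᵥ
      (fun j => edgeCoeff h (-θ₀) θ₀ j * ⟪a j, C f⟫_ℂ) = 0 := by
  set y : J → ℂ := fun j => edgeCoeff h (-θ₀) θ₀ j * ⟪a j, C f⟫_ℂ with hy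
  have hrc : ∀ j, ⟪b j, C f⟫_ℂ = r j * Complex.exp (θ₀ j * Complex.I) * ⟪a j, C f⟫_ℂ := by
    intro j
    have h1 := congrArg (starRingEnd ℂ) (hr j)
    rw [map_mul, map_mul, conj_exp_mul_I, Complex.conj_ofReal, ← hC.inner_left_map,
      ← hC.inner_right_map] at h1
    linear_combination Complex.exp (θ₀ j * Complex.I) * h1 -
        ⟪b j, C f⟫_ℂ * exp_mul_exp_neg_mul_I (θ₀ j)
  have hTC : edgePencil S h a b (-θ₀) (C f) = (l : ℂ) • C f := by
    have : edgePencil S h a b θ₀ f = (l : ℂ) • f := by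
      rw [← sub_eq_zero, ← hAl, hAf]
    rw [← hC.map_edgePencil, this, LinearMap.map_smulₛₗ, Complex.conj_ofReal]
  -- `C f` is an eigenvector at `-θ₀` with the same eigenvalue, so `A (C f)` is the difference of
  -- the two pencils applied to `C f`, a combination of edge vectors. Hence `∑ y_k p_k` equals `-C
  -- f` modulo the kernel of `A`, and each row of the reduced matrix can be evaluated explicitly.
  have hsum : A (C f) + ∑ k, y k • edgeVector a b θ₀ r k = 0 := by
    rw [hAl, ← hTC, edgePencil_apply, edgePencil_apply, add_sub_add_left_eq_sub,
      ← Finset.sum_sub_distrib, ← Finset.sum_add_distrib]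
    refine Finset.sum_eq_zero fun j _ => ?_
    simp only [hy, edgeCoeff, edgeVector, hrc, Pi.neg_apply, Complex.ofReal_neg, neg_mul, neg_neg]
    module
  have hP : A (∑ k, y k • p k) = -A (C f) := by
    rw [map_sum, eq_neg_iff_add_eq_zero, add_comm, ← hsum]
    simp only [map_smul, hp]
  ext j
  rw [reducedMatrix_mulVec, hP, inner_neg_right, ← hA, hp, inner_edgeVector, hrc]
  have h1 : (h j : ℂ) ≠ 0 := by exact_mod_cast hh j
  simp only [hy, edgeCoeff, Pi.neg_apply, Complex.ofReal_neg, neg_mul, neg_neg, Complex.ofReal_div,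
    Pi.zero_apply]
  field_simp
  ring

/-- At a time-reversal invariant quasimomentum, the reduced matrix, written in the coordinates
given by the derivative of the quasimomentum, is real. -/
theorem IsTimeReversal.reducedMatrix_im_eq_zero (hC : IsTimeReversal C S a b)
    (hA : A.IsSymmetric)
    (hAl : ∀ x, A x = edgePencil S h a b θ₀ x - (l : ℂ) • x) (hAf : A f = 0)
    (hker : ∀ z, A z = 0 → ∃ c : ℂ, z = c • f)
    (hp : ∀ j, A (p j) = edgeVector a b θ₀ r j)
    (hsymm : ∀ j, Complex.exp (-(θ₀ j * Complex.I)) = Complex.exp (θ₀ j * Complex.I))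
    (ω : J → ℝ) (j k : J) :
    (conj (-Complex.I * h j * Complex.exp (-(θ₀ j * Complex.I)) * ⟪a j, f⟫_ℂ) *
      reducedMatrix A ω p j k *
      (-Complex.I * h k * Complex.exp (-(θ₀ k * Complex.I)) * ⟪a k, f⟫_ℂ)).im = 0 := by
  have hAC : ∀ x, A (C x) = C (A x) := by
    intro x
    have h1 : edgePencil S h a b (-θ₀) = edgePencil S h a b θ₀ := by
      ext x
      simp only [edgePencil_apply, Pi.neg_apply, Complex.ofReal_neg, neg_mul, neg_neg, hsymm]
    rw [hAl, hAl, map_sub, hC.map_edgePencil, h1, LinearMap.map_smulₛₗ, Complex.conj_ofReal]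
  have hCw : ∀ j, C (edgeVector a b θ₀ r j) = edgeVector a b θ₀ r j := by
    intro j
    rw [edgeVector, map_sub, LinearMap.map_smulₛₗ, map_mul, conj_exp_mul_I, hsymm,
      Complex.conj_ofReal, hC.map_left, hC.map_right]
  have hfw : ∀ k, ⟪f, edgeVector a b θ₀ r k⟫_ℂ = 0 := by
    intro k
    rw [← hp, ← hA, hAf, inner_zero_left]
  have hreal : ∀ j k, conj ⟪p j, A (p k)⟫_ℂ = ⟪p j, A (p k)⟫_ℂ := by
    intro j k
    -- `A` now commutes with `C`, so `p j` is real up to a multiple of `f`, which is orthogonal to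
    -- all edge vectors.
    obtain ⟨c, hc⟩ := hker (C (p j) - p j) (by rw [map_sub, hAC, hp, hCw, sub_self])
    rw [hp, ← hC.inner_map_map, hCw, sub_eq_iff_eq_add.1 hc, inner_add_left, inner_smul_left,
      hfw, mul_zero, zero_add]
  have hW : conj (reducedMatrix A ω p j k) = reducedMatrix A ω p j k := by
    classical
    simp only [reducedMatrix, Matrix.sub_apply, Matrix.of_apply, map_sub, hreal]
    congr 1
    rw [Matrix.diagonal_apply]
    split_ifs <;> simp
  -- One constant `c` serves all edges, so the values `⟪a j, f⟫_ℂ` share a common phase up to sign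
  -- and their phases cancel between row and column.
  obtain ⟨c, hc⟩ := hker (C f) (by rw [hAC, hAf, map_zero])
  have hac : ∀ j, conj ⟪a j, f⟫_ℂ = c * ⟪a j, f⟫_ℂ := fun j => by
    rw [← hC.inner_left_map, hc, inner_smul_right]
  rw [← Complex.conj_eq_iff_im]
  simp only [map_mul, Complex.conj_conj, hW]
  simp only [map_neg, Complex.conj_I, Complex.conj_ofReal, conj_exp_mul_I, hac, hsymm]
  ring

end TimeReversal

/-! ### Local minima of pencil eigenvalues are global. -/

section LocalMin

variable {E : Type*} [NormedAddCommGroup E] [InnerProductSpace ℂ E] [FiniteDimensional ℂ E]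
  {J : Type*} [Fintype J] {C : E →ₛₗ[starRingEnd ℂ] E} {S : E →ₗ[ℂ] E} {h : J → ℝ} {a b : J → E}
  {θ₀ : J → ℝ} {L : (J → ℝ) → ℝ} {m q : ℕ} {f : E}

theorem exists_le_add_mul_norm_sq_of_isLocalMin (hS : S.IsSymmetric)
    (hh : ∀ j, h j ≠ 0) (hL : ∀ θ, IsMinimaxValue (edgePencil S h a b θ) (L θ) m q)
    (hf : ‖f‖ = 1)
    (hker : ∀ z, edgePencil S h a b θ₀ z = (L θ₀ : ℂ) • z → ∃ c : ℂ, z = c • f)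
    (haf : ∀ j, ⟪a j, f⟫_ℂ ≠ 0) (hmin : IsLocalMin L θ₀) :
    ∃ K, ∀ θ, L θ ≤ L θ₀ + K * ‖θ - θ₀‖ ^ 2 := by
  let A : E →ₗ[ℂ] E := edgePencil S h a b θ₀ - (L θ₀ : ℂ) • LinearMap.id
  have hAl : ∀ x, A x = edgePencil S h a b θ₀ x - (L θ₀ : ℂ) • x := fun x => rfl
  have hA : A.IsSymmetric := (edgePencil_isSymmetric hS h a b θ₀).sub
    (LinearMap.IsSymmetric.id.smul (Complex.conj_ofReal _))
  have hker' : ∀ z, A z = 0 → ∃ c : ℂ, z = c • f := fun z hz =>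
    hker z (sub_eq_zero.1 ((hAl z).symm.trans hz))
  obtain ⟨r, hr⟩ := exists_real_ratio hh hL hf hAl hker' haf hmin
  obtain ⟨p, hp⟩ := exists_preimage_edgeVector hA hker' hr
  exact exists_le_add_mul_norm_sq hh hL hA hAl hp

/-- A local minimum of an eigenvalue of a time-reversal symmetric edge pencil is global, provided
that the point is time-reversal invariant, or there are at most two edges, or there are at most
three edges and the minimum is non-degenerate. -/
theorem le_of_isLocalMin (hC : IsTimeReversal C S a b) (hS : S.IsSymmetric)
    (hh : ∀ j, h j ≠ 0) (hL : ∀ θ, IsMinimaxValue (edgePencil S h a b θ) (L θ) m q)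
    (hf : ‖f‖ = 1) (hTf : edgePencil S h a b θ₀ f = (L θ₀ : ℂ) • f)
    (hker : ∀ z, edgePencil S h a b θ₀ z = (L θ₀ : ℂ) • z → ∃ c : ℂ, z = c • f)
    (haf : ∀ j, ⟪a j, f⟫_ℂ ≠ 0) (hmin : IsLocalMin L θ₀)
    (hcase : (∀ j, Complex.exp (-(θ₀ j * Complex.I)) = Complex.exp (θ₀ j * Complex.I)) ∨
      Fintype.card J ≤ 2 ∨ (Fintype.card J ≤ 3 ∧ ∀ δ : J → ℝ, δ ≠ 0 →
        ¬ ∀ ε : ℝ, 0 < ε → ∀ᶠ t in 𝓝[>] (0 : ℝ), L (θ₀ + t • δ) ≤ L θ₀ + t ^ 2 * ε))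
    (θ : J → ℝ) : L θ₀ ≤ L θ := by
  classical
  let A : E →ₗ[ℂ] E := edgePencil S h a b θ₀ - (L θ₀ : ℂ) • LinearMap.id
  have hAl : ∀ x, A x = edgePencil S h a b θ₀ x - (L θ₀ : ℂ) • x := fun x => rfl
  have hA : A.IsSymmetric := (edgePencil_isSymmetric hS h a b θ₀).sub
    (LinearMap.IsSymmetric.id.smul (Complex.conj_ofReal _))
  have hAf : A f = 0 := by rw [hAl, hTf, sub_self]
  have hker' : ∀ z, A z = 0 → ∃ c : ℂ, z = c • f := fun z hz =>
    hker z (sub_eq_zero.1 ((hAl z).symm.trans hz))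
  obtain ⟨r, hr⟩ := exists_real_ratio hh hL hf hAl hker' haf hmin
  obtain ⟨p, hp⟩ := exists_preimage_edgeVector hA hker' hr
  set W₀ := reducedMatrix A (fun j => -r j / h j) p with hW₀
  -- In the coordinates `y = Θ * t` the velocities of `y` at `f` become the real vectors, and
  -- reality of the matrix at a corner can be expressed.
  let Θ : J → ℂ := fun j => -Complex.I * h j * Complex.exp (-(θ₀ j * Complex.I)) * ⟪a j, f⟫_ℂ
  have hΘ : ∀ j, Θ j ≠ 0 := fun j => by
    simp [Θ, hh j, haf j]
  let W : Matrix J J ℂ := Matrix.of fun j k => conj (Θ j) * W₀ j k * Θ k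
  have hWv : ∀ y j, (W *ᵥ y) j = conj (Θ j) * (W₀ *ᵥ (Θ * y)) j := by
    intro y j
    simp only [W, Matrix.mulVec, dotProduct, Matrix.of_apply, Finset.mul_sum, Pi.mul_apply,
      mul_assoc]
  have hWf : ∀ y, W.reForm y = W₀.reForm (Θ * y) := by
    intro y
    simp only [Matrix.reForm, dotProduct, hWv, Pi.star_apply, Pi.mul_apply, Complex.star_def,
      map_mul]
    congr 1
    exact Finset.sum_congr rfl fun j _ => by ring
  have hW₀H : W₀.IsHermitian := reducedMatrix_isHermitian hA _ p
  have hWH : W.IsHermitian := by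
    ext j k
    have := hW₀H.apply j k
    rw [Complex.star_def] at this
    simp only [W, Matrix.conjTranspose_apply, Matrix.of_apply, Complex.star_def, map_mul,
      Complex.conj_conj, this]
    ring
  have hreal : ∀ t : J → ℝ, W.reForm (fun j => (t j : ℂ)) = W₀.reForm (fun j =>
      -Complex.I * h j * Complex.exp (-(θ₀ j * Complex.I)) * t j * ⟪a j, f⟫_ℂ) := by
    intro t
    rw [hWf]
    congr 1
    ext j
    simp only [Θ, Pi.mul_apply]
    ring
  have hpos : ∀ t : J → ℝ, 0 ≤ W.reForm fun j => (t j : ℂ) := by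
    intro t
    rw [hreal]
    exact nonneg_of_isLocalMin_of_eventually_le hmin (s := fun t => t ^ 2)
      (fun t ht => by positivity)
      fun ε hε => eventually_le_add_sq_mul hh hL hf hA hAl hker' hp t hε
  have hnonneg : ∀ y, 0 ≤ W.reForm y := by
    by_cases hsymm : ∀ j, Complex.exp (-(θ₀ j * Complex.I)) = Complex.exp (θ₀ j * Complex.I)
    · exact hWH.reForm_nonneg_of_real (fun j k =>
        hC.reducedMatrix_im_eq_zero hA hAl hAf hker' hp hsymm _ j k) hpos
    · have hy := hC.reducedMatrix_mulVec_eq_zero hh hA hAl hAf hr hp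
      set y : J → ℂ := fun j => edgeCoeff h (-θ₀) θ₀ j * ⟪a j, C f⟫_ℂ with hydef
      have hΘy : Θ * (Θ⁻¹ * y) = y := by
        ext j
        simp [hΘ j]
      have hWy : W *ᵥ (Θ⁻¹ * y) = 0 := by
        ext j
        rw [hWv, hΘy, hy]
        simp
      -- If the kernel vector vanished, then, `f` being non-zero at every `a j`, each phase would
      -- equal its conjugate, which is the case already treated.
      have hy0 : Θ⁻¹ * y ≠ 0 := by
        intro h0
        rw [h0, mul_zero] at hΘy
        refine hsymm fun j => ?_
        have h1 : edgeCoeff h (-θ₀) θ₀ j * ⟪a j, C f⟫_ℂ = 0 := congrFun hΘy.symm j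
        rw [hC.inner_left_map, mul_eq_zero, or_iff_left ((map_ne_zero _).2 (haf j)), edgeCoeff,
          mul_eq_zero, or_iff_right (by exact_mod_cast hh j), sub_eq_zero] at h1
        simpa using h1.symm
      rcases hcase with h1 | h1 | ⟨h1, h2⟩
      · exact absurd h1 hsymm
      · exact hWH.reForm_nonneg_of_card_le_two h1 hpos hy0 hWy
      · refine hWH.reForm_nonneg_of_card_le_three h1 (fun t ht => ?_) hy0 hWy
        -- A zero of the form at a real vector would leave growth slower than any multiple of `t ^
        -- 2` in that direction, which the third case forbids.
        refine (hpos t).lt_of_ne fun h0 => h2 t ht fun ε hε => ?_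
        have := eventually_le_add_sq_mul hh hL hf hA hAl hker' hp t hε
        rwa [← hreal, ← h0, zero_add] at this
  refine le_of_reForm_reducedMatrix_nonneg hh hL hA hAl hp (fun y => ?_) θ
  have h1 : Θ * (Θ⁻¹ * y) = y := by
    ext j
    simp [hΘ j]
  have := hnonneg (Θ⁻¹ * y)
  rwa [hWf, h1] at this

end LocalMin

/-! ### From an invertible Hessian to quadratic growth. -/

section SecondDerivative

variable {E : Type*} [NormedAddCommGroup E] [NormedSpace ℝ E] {φ : E → ℝ} {x : E}

/-- Near `x` the increment of `φ` is squeezed between `0` and a multiple of `‖y - x‖ ^ 2`. -/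
theorem hasFDerivAt_zero_of_isLocalMin_of_le (hmin : IsLocalMin φ x) {K : ℝ}
    (hK : ∀ y, φ y ≤ φ x + K * ‖y - x‖ ^ 2) : HasFDerivAt φ (0 : E →L[ℝ] ℝ) x := by
  refine .of_isLittleO ?_
  have h1 : (fun y => φ y - φ x - (0 : E →L[ℝ] ℝ) (y - x)) =O[𝓝 x] fun y => ‖y - x‖ ^ 2 := by
    refine IsBigO.of_bound K ?_
    filter_upwards [hmin] with y hy
    simp only [zero_apply, sub_zero, Real.norm_eq_abs]
    rw [abs_of_nonneg (sub_nonneg.2 hy), abs_of_nonneg (by positivity)]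
    linarith [hK y]
  refine h1.trans_isLittleO ?_
  have h2 : (fun z : E => ‖z‖ ^ 2) =o[𝓝 0] fun z => z := by
    simpa using (isLittleO_norm_pow_id (E' := E) one_lt_two)
  have h3 : Tendsto (fun y => y - x) (𝓝 x) (𝓝 0) := by
    simpa using (continuous_sub_right x).tendsto x
  exact h2.comp_tendsto h3

/-- Second-order Taylor expansion along a line through a critical point. -/
theorem tendsto_second_difference {L : E →L[ℝ] E →L[ℝ] ℝ} {φ' : E → E →L[ℝ] ℝ}
    (hdiff : ∀ᶠ y in 𝓝 x, HasFDerivAt φ (φ' y) y) (h0 : φ' x = 0) (hL : HasFDerivAt φ' L x)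
    (η : E) :
    Tendsto (fun t : ℝ => (φ (x + t • η) - φ x) / t ^ 2) (𝓝[>] 0) (𝓝 (L η η / 2)) := by
  obtain ⟨R, hR, hball⟩ := Metric.eventually_nhds_iff_ball.1 hdiff
  -- The Taylor lemma needs the endpoint inside the ball, so `η` is shrunk by `c` and the limit
  -- rescaled at the end.
  obtain ⟨c, hc, hcη⟩ : ∃ c : ℝ, 0 < c ∧ x + c • η ∈ Metric.ball x R := by
    have : Tendsto (fun c : ℝ => x + c • η) (𝓝[>] 0) (𝓝 x) := by
      have : Tendsto (fun t : ℝ => x + t • η) (𝓝 0) (𝓝 (x + (0 : ℝ) • η)) :=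
        Continuous.tendsto (by fun_prop) 0
      rw [zero_smul, add_zero] at this
      exact this.mono_left nhdsWithin_le_nhds
    obtain ⟨c, h1, h2⟩ := ((this.eventually (Metric.ball_mem_nhds x hR)).and
      self_mem_nhdsWithin).exists
    exact ⟨c, h2, h1⟩
  have hint : interior (Metric.ball x R) = Metric.ball x R := Metric.isOpen_ball.interior_eq
  have key := (convex_ball x R).taylor_approx_two_segment (f := φ) (f' := φ') (f'' := L)
    (fun y hy => (hball y (hint ▸ hy)))
    (Metric.mem_ball_self hR) hL.hasFDerivWithinAt (v := 0) (w := c • η)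
    (by simpa [hint] using hR) (by simpa [hint] using hcη)
  have h1 : Tendsto (fun t : ℝ => (φ (x + t • c • η) - φ x) / t ^ 2) (𝓝[>] 0)
      (𝓝 (c ^ 2 * (L η η / 2))) := by
    have h2 := key.tendsto_div_nhds_zero.add_const (c ^ 2 * (L η η / 2))
    rw [zero_add] at h2
    refine h2.congr' ?_
    filter_upwards [self_mem_nhdsWithin] with t ht
    have ht : (0 : ℝ) < t := ht
    simp only [smul_zero, add_zero, h0, map_zero, map_smul, zero_apply,
      smul_apply, smul_eq_mul, mul_zero, sub_zero]
    field_simp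
    ring
  have h3 : Tendsto (fun t : ℝ => t / c) (𝓝[>] 0) (𝓝[>] 0) := by
    refine tendsto_nhdsWithin_iff.2 ⟨?_, ?_⟩
    · have : Tendsto (fun t : ℝ => t / c) (𝓝 0) (𝓝 (0 / c)) := (continuous_id.div_const c).tendsto 0
      rw [zero_div] at this
      exact this.mono_left nhdsWithin_le_nhds
    · filter_upwards [self_mem_nhdsWithin] with t ht
      exact div_pos ht hc
  have h4 := (h1.comp h3).const_mul ((c ^ 2)⁻¹)
  rw [inv_mul_cancel_left₀ (by positivity)] at h4
  refine h4.congr fun t => ?_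
  simp only [Function.comp_apply, smul_smul, div_mul_cancel₀ _ hc.ne', div_pow]
  field_simp

/-- A non-degenerate local minimum at which the function is bounded above quadratically grows
quadratically in every direction. -/
theorem not_forall_eventually_le_of_injective [FiniteDimensional ℝ E]
    {L : E →L[ℝ] E →L[ℝ] ℝ} (hmin : IsLocalMin φ x) {K : ℝ}
    (hK : ∀ y, φ y ≤ φ x + K * ‖y - x‖ ^ 2) (hL : HasFDerivAt (fderiv ℝ φ) L x)
    (hinj : Function.Injective L) {η : E} (hη : η ≠ 0) :
    ¬ ∀ ε : ℝ, 0 < ε → ∀ᶠ t in 𝓝[>] (0 : ℝ), φ (x + t • η) ≤ φ x + t ^ 2 * ε := by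
  intro hle
  have hx := hasFDerivAt_zero_of_isLocalMin_of_le hmin hK
  obtain ⟨c, -, hc⟩ := L.toLinearMap.exists_antilipschitzWith (LinearMap.ker_eq_bot.2 hinj)
  -- Differentiability near `x` is not assumed. Where it fails, `fderiv` takes the default value
  -- `0`; but the injective derivative `L` forces `fderiv ℝ φ y ≠ 0` for all `y ≠ x` near `x`.
  have hdiff : ∀ᶠ y in 𝓝 x, HasFDerivAt φ (fderiv ℝ φ y) y := by
    have h1 : ∀ᶠ y in 𝓝[≠] x, HasFDerivAt φ (fderiv ℝ φ y) y := by
      filter_upwards [hL.eventually_ne (c := 0) ⟨c, hc⟩] with y hy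
      by_contra hnd
      exact hy (fderiv_zero_of_not_differentiableAt fun h => hnd h.hasFDerivAt)
    rw [eventually_nhdsWithin_iff] at h1
    filter_upwards [h1] with y hy
    by_cases hyx : y = x
    · rw [hyx]; exact hx.differentiableAt.hasFDerivAt
    · exact hy hyx
  have hsymm := second_derivative_symmetric_of_eventually hdiff hL
  have htaylor := tendsto_second_difference hdiff hx.fderiv hL
  have hnonneg : ∀ v, 0 ≤ L v v := by
    intro v
    have h1 : Tendsto (fun t : ℝ => x + t • v) (𝓝[>] 0) (𝓝 x) := by
      have : Tendsto (fun t : ℝ => x + t • v) (𝓝 0) (𝓝 (x + (0 : ℝ) • v)) :=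
        Continuous.tendsto (by fun_prop) 0
      rw [zero_smul, add_zero] at this
      exact this.mono_left nhdsWithin_le_nhds
    have := ge_of_tendsto (htaylor v) (b := 0) ((h1.eventually hmin).mono fun t ht =>
      div_nonneg (sub_nonneg.2 ht) (sq_nonneg t))
    linarith
  have hzero : L η η = 0 := by
    refine le_antisymm ?_ (hnonneg η)
    refine le_of_forall_pos_le_add fun ε hε => ?_
    have := le_of_tendsto (htaylor η) (b := ε / 2) (by
      filter_upwards [hle (ε / 2) (by positivity), self_mem_nhdsWithin] with t ht ht0
      have ht0 : (0 : ℝ) < t := ht0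
      rw [div_le_iff₀ (by positivity)]
      linarith)
    linarith
  refine hη (hinj ?_)
  rw [map_zero]
  ext v
  -- A null vector of a non-negative symmetric form lies in its radical: expand the form at `s • η +
  -- v`.
  have h1 : ∀ s : ℝ, 0 ≤ 2 * s * L η v + L v v := by
    intro s
    have h2 := hnonneg (s • η + v)
    simp only [map_add, map_smul, add_apply, smul_apply,
      smul_eq_mul, hzero, hsymm v η] at h2
    linarith
  by_contra hne
  rw [zero_apply] at hne
  -- This value of `s` would make the expression equal to `-1`.
  have h2 := h1 (-(L v v + 1) / (2 * L η v))
  have h3 : 2 * (-(L v v + 1) / (2 * L η v)) * L η v = -(L v v + 1) := by field_simp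
  linarith

theorem not_forall_eventually_le_of_det_hessianMatrix_ne_zero {d : ℕ}
    {φ : (Fin d → ℝ) → ℝ} {x : Fin d → ℝ} (hmin : IsLocalMin φ x) {K : ℝ}
    (hK : ∀ y, φ y ≤ φ x + K * ‖y - x‖ ^ 2) (hdet : (hessianMatrix φ x).det ≠ 0)
    {η : Fin d → ℝ} (hη : η ≠ 0) :
    ¬ ∀ ε : ℝ, 0 < ε → ∀ᶠ t in 𝓝[>] (0 : ℝ), φ (x + t • η) ≤ φ x + t ^ 2 * ε := by
  have hM : ∀ i j, hessianMatrix φ x i j =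
      fderiv ℝ (fderiv ℝ φ) x (Pi.single i 1) (Pi.single j 1) := fun i j => by
    simp [hessianMatrix, iteratedFDeriv_two_apply]
  have hd : DifferentiableAt ℝ (fderiv ℝ φ) x := by
    -- Otherwise the second derivative is the default `0`, and so is the Hessian; `η ≠ 0` ensures
    -- that it has a row at all.
    by_contra hnd
    obtain ⟨i, -⟩ := Function.ne_iff.1 hη
    refine hdet (Matrix.det_eq_zero_of_row_eq_zero i fun j => ?_)
    rw [hM, fderiv_zero_of_not_differentiableAt hnd]
    simp
  refine not_forall_eventually_le_of_injective hmin hK hd.hasFDerivAt ?_ hη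
  rw [injective_iff_map_eq_zero]
  intro v hv
  refine Matrix.eq_zero_of_vecMul_eq_zero hdet ?_
  ext j
  have h1 : fderiv ℝ (fderiv ℝ φ) x v (Pi.single j 1) = 0 := by rw [hv]; simp
  rw [pi_eq_sum_univ' v] at h1
  simpa [Matrix.vecMul, dotProduct, hM, sum_apply] using h1

end SecondDerivative

/-! ### Freeness of the action and the crossing edges. -/

section PeriodicGraph

variable {d : ℕ} {V : Type*} [AddAction (Fin d → ℤ) V] {Γ : SimpleGraph V} {F : Finset V}

/-- The action on a connected periodic graph is free. -/
theorem IsPeriodicGraph.eq_zero_of_vadd_eq (hΓ : IsPeriodicGraph d Γ) (hc : Γ.Connected)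
    {g : Fin d → ℤ} {v : V} (hg : g +ᵥ v = v) : g = 0 := by
  have hstep : ∀ u w : V, Γ.Adj u w → (∃ n : ℕ, 0 < n ∧ (n • g) +ᵥ u = u) →
      ∃ n : ℕ, 0 < n ∧ (n • g) +ᵥ w = w := by
    rintro u w huw ⟨n, hn, hu⟩
    have hfix : ∀ k : ℕ, (k • n • g) +ᵥ u = u := by
      intro k
      induction k with
      | zero => simp
      | succ k ih => rw [succ_nsmul, add_vadd, hu, ih]
    have hmaps : ∀ k : ℕ, (k • n • g) +ᵥ w ∈ Γ.neighborSet u := by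
      intro k
      rw [SimpleGraph.mem_neighborSet]
      nth_rw 1 [← hfix k]
      exact (hΓ.adj_vadd_iff _ _ _).2 huw
    -- Multiples of `g` that fix `u` permute its finitely many neighbours, so by pigeonhole a
    -- positive multiple of `g` also fixes `w`. By connectedness this spreads to all vertices.
    obtain ⟨i, -, j, -, hij, heq⟩ := Set.infinite_univ.exists_ne_map_eq_of_mapsTo
      (f := fun k : ℕ => (k • n • g) +ᵥ w) (t := Γ.neighborSet u) (fun k _ => hmaps k)
      (hΓ.locallyFinite u)
    wlog hlt : i < j generalizing i j
    · exact this j i hij.symm heq.symm (by omega)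
    refine ⟨(j - i) * n, Nat.mul_pos (by omega) hn, ?_⟩
    have h1 : (j • n • g) = (i • n • g) + ((j - i) * n) • g := by
      rw [mul_nsmul', ← add_nsmul]
      congr 1; omega
    simp only [h1, add_vadd] at heq
    exact (vadd_left_cancel _ heq).symm
  have hall : ∀ w : V, ∃ n : ℕ, 0 < n ∧ (n • g) +ᵥ w = w := by
    intro w
    obtain ⟨walk⟩ := hc.preconnected v w
    have : ∀ {u w : V}, Γ.Walk u w → (∃ n : ℕ, 0 < n ∧ (n • g) +ᵥ u = u) →
        ∃ n : ℕ, 0 < n ∧ (n • g) +ᵥ w = w := by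
      intro u w walk
      induction walk with
      | nil => exact id
      | cons hadj _ ih => exact fun h => ih (hstep _ _ hadj h)
    exact this walk ⟨1, one_pos, by rw [one_nsmul, hg]⟩
  choose n hn hfix using hall
  have := hΓ.cofinite
  have := Fintype.ofFinite (AddAction.orbitRel.Quotient (Fin d → ℤ) V)
  -- The multiple `N • g` fixes a representative of every orbit, hence, the group being abelian,
  -- every vertex. Faithfulness and absence of torsion then give `g = 0`.
  let N := ∏ o : AddAction.orbitRel.Quotient (Fin d → ℤ) V, n o.out
  have hN : 0 < N := Finset.prod_pos fun o _ => hn _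
  have hNfix : ∀ w : V, (N • g) +ᵥ w = w := by
    intro w
    let o : AddAction.orbitRel.Quotient (Fin d → ℤ) V := Quotient.mk'' w
    obtain ⟨k, hk⟩ : n o.out ∣ N := Finset.dvd_prod_of_mem (fun o => n (Quotient.out o))
      (Finset.mem_univ o)
    have hk' : ∀ k : ℕ, (k • n o.out • g) +ᵥ o.out = o.out := by
      intro k
      induction k with
      | zero => simp
      | succ k ih => rw [succ_nsmul, add_vadd, hfix, ih]
    have hw : w ∈ AddAction.orbit (Fin d → ℤ) o.out := by
      have : (AddAction.orbitRel (Fin d → ℤ) V) o.out w := Quotient.mk_out (s := _) w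
      exact AddAction.orbitRel_apply.1 ((AddAction.orbitRel (Fin d → ℤ) V).symm this)
    obtain ⟨a, ha⟩ := hw
    have ha : a +ᵥ o.out = w := ha
    rw [← ha, ← add_vadd, add_comm, add_vadd, hk, mul_nsmul, hk']
  have := hΓ.faithful
  have h0 : N • g = 0 := eq_of_vadd_eq_vadd fun w => by rw [hNfix, zero_vadd]
  exact (smul_eq_zero.1 h0).resolve_left hN.ne'

theorem IsPeriodicGraph.eq_of_vadd_eq_vadd (hΓ : IsPeriodicGraph d Γ) (hc : Γ.Connected)
    {g g' : Fin d → ℤ} {v : V} (h : g +ᵥ v = g' +ᵥ v) : g = g' := by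
  rw [← sub_eq_zero]
  refine hΓ.eq_zero_of_vadd_eq hc (v := v) ?_
  rw [sub_eq_neg_add, add_vadd, h, ← add_vadd, neg_add_cancel, zero_vadd]

theorem IsFundamentalDomainFor.eq_of_vadd_eq (hF : IsFundamentalDomainFor d F) {u v : V}
    (hu : u ∈ F) (hv : v ∈ F) {g : Fin d → ℤ} (h : g +ᵥ v = u) : u = v :=
  (hF v).unique ⟨hu, ⟨g, h⟩⟩ ⟨hv, AddAction.mem_orbit_self v⟩

theorem IsFundamentalDomainFor.exists_vadd (hF : IsFundamentalDomainFor d F) (w : V) :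
    ∃ (g : Fin d → ℤ) (v : F), w = g +ᵥ (v : V) := by
  obtain ⟨v, ⟨hv, g, hg⟩, -⟩ := hF w
  refine ⟨-g, ⟨v, hv⟩, ?_⟩
  change w = -g +ᵥ v
  rw [← hg]
  simp

/-- Crossing edges `u ∼ g v` with `u, v` in the fundamental domain. -/
def crossingTriples (Γ : SimpleGraph V) (F : Finset V) : Set (F × (Fin d → ℤ) × F) :=
  {e | e.2.1 ≠ 0 ∧ Γ.Adj e.1 (e.2.1 +ᵥ (e.2.2 : V))}

theorem vadd_mem_iff_eq_zero (hΓ : IsPeriodicGraph d Γ)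
    (hF : HasOneCrossingEdgePerGenerator d Γ F) (v : F) (g : Fin d → ℤ) :
    g +ᵥ (v : V) ∈ F ↔ g = 0 := by
  refine ⟨fun h => ?_, fun h => by rw [h, zero_vadd]; exact v.2⟩
  exact hΓ.eq_zero_of_vadd_eq hF.connected (hF.fundamental.eq_of_vadd_eq h v.2 rfl)

/-- By freeness, `(u, g, v)` is recovered from the pair `(u, g +ᵥ v)`. -/
theorem encard_crossingTriples (hΓ : IsPeriodicGraph d Γ)
    (hF : HasOneCrossingEdgePerGenerator d Γ F) :
    (crossingTriples (d := d) Γ F).encard = 2 * d := by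
  rw [← hF.crossing]
  have hinj : Set.InjOn (fun e : F × (Fin d → ℤ) × F => ((e.1 : V), e.2.1 +ᵥ (e.2.2 : V)))
      (crossingTriples (d := d) Γ F) := by
    rintro ⟨u, g, v⟩ - ⟨u', g', v'⟩ - h
    simp only [Prod.mk.injEq] at h
    obtain ⟨h1, h2⟩ := h
    have h3 : v = v' := Subtype.ext (hF.fundamental.eq_of_vadd_eq (g := -g + g') v.2 v'.2
      (by rw [add_vadd, ← h2, ← add_vadd, neg_add_cancel, zero_vadd]))
    subst h3
    rw [Subtype.ext h1, hΓ.eq_of_vadd_eq_vadd hF.connected h2]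
  rw [← hinj.encard_image]
  congr 1
  ext ⟨u, w⟩
  simp only [Set.mem_image, Set.mem_ofPred_eq, crossingTriples, Prod.mk.injEq]
  constructor
  · rintro ⟨⟨u, g, v⟩, ⟨hg, hadj⟩, rfl, rfl⟩
    exact ⟨u.2, fun h => hg ((vadd_mem_iff_eq_zero hΓ hF v g).1 h), hadj⟩
  · rintro ⟨hu, hw, hadj⟩
    obtain ⟨g, v, rfl⟩ := hF.fundamental.exists_vadd w
    exact ⟨⟨⟨u, hu⟩, g, v⟩, ⟨fun h => hw ((vadd_mem_iff_eq_zero hΓ hF v g).2 h), hadj⟩, rfl, rfl⟩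

/-- The same edge seen from its other end. -/
def reverseTriple (e : F × (Fin d → ℤ) × F) : F × (Fin d → ℤ) × F := (e.2.2, -e.2.1, e.1)

omit [AddAction (Fin d → ℤ) V] in
theorem reverseTriple_reverseTriple (e : F × (Fin d → ℤ) × F) :
    reverseTriple (reverseTriple e) = e := by
  simp [reverseTriple]

theorem reverseTriple_mem (hΓ : IsPeriodicGraph d Γ) {e : F × (Fin d → ℤ) × F}
    (he : e ∈ crossingTriples Γ F) : reverseTriple e ∈ crossingTriples Γ F := by
  refine ⟨neg_ne_zero.2 he.1, ?_⟩
  have := (hΓ.adj_vadd_iff (-e.2.1) _ _).2 he.2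
  rw [← add_vadd, neg_add_cancel, zero_vadd] at this
  exact this.symm

/-- Crossing edges oriented so that their translation is lexicographically positive. -/
def positiveTriples (Γ : SimpleGraph V) (F : Finset V) : Set (F × (Fin d → ℤ) × F) :=
  {e | e ∈ crossingTriples Γ F ∧ 0 < toLex e.2.1}

/-- The lexicographic order is total and negation reverses it, so it selects exactly one of the two
orientations of each crossing edge. This turns the count `2 * d` into `d`. -/
theorem crossingTriples_eq_union (hΓ : IsPeriodicGraph d Γ) :
    crossingTriples (d := d) Γ F =
      positiveTriples Γ F ∪ reverseTriple '' positiveTriples Γ F := by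
  ext e
  constructor
  · intro he
    rcases lt_trichotomy 0 (toLex e.2.1) with h | h | h
    · exact Or.inl ⟨he, h⟩
    · exact absurd (toLex_eq_zero.1 h.symm) he.1
    · refine Or.inr ⟨reverseTriple e, ⟨reverseTriple_mem hΓ he, ?_⟩,
        reverseTriple_reverseTriple e⟩
      change 0 < toLex (-e.2.1)
      rw [toLex_neg]
      exact neg_pos.2 h
  · rintro (he | ⟨e, he, rfl⟩)
    · exact he.1
    · exact reverseTriple_mem hΓ he.1

theorem disjoint_positiveTriples :
    Disjoint (positiveTriples (d := d) Γ F) (reverseTriple '' positiveTriples Γ F) := by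
  rw [Set.disjoint_left]
  rintro _ h ⟨e, he, rfl⟩
  have h1 : 0 < toLex (-e.2.1) := h.2
  rw [toLex_neg] at h1
  exact lt_asymm he.2 (neg_pos.1 h1)

theorem encard_positiveTriples (hΓ : IsPeriodicGraph d Γ)
    (hF : HasOneCrossingEdgePerGenerator d Γ F) :
    (positiveTriples (d := d) Γ F).encard = d := by
  have h := encard_crossingTriples hΓ hF
  have hinj : Function.Injective (reverseTriple (d := d) (F := F)) :=
    Function.LeftInverse.injective reverseTriple_reverseTriple
  rw [crossingTriples_eq_union hΓ, Set.encard_union_eq disjoint_positiveTriples,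
    hinj.encard_image, ← two_mul] at h
  have hfin : (positiveTriples (d := d) Γ F).encard ≠ ⊤ := fun h0 => by
    rw [h0, ENat.mul_top (by simp)] at h
    exact ENat.top_ne_natCast (2 * d) (by exact_mod_cast h)
  lift (positiveTriples (d := d) Γ F).encard to ℕ using hfin with k
  norm_cast at h ⊢
  omega

/-- The translations of the positive crossing edges generate the group of periods. -/
theorem closure_positiveTriples (hΓ : IsPeriodicGraph d Γ)
    (hF : HasOneCrossingEdgePerGenerator d Γ F) (hne : F.Nonempty) :
    AddSubgroup.closure ((fun e : F × (Fin d → ℤ) × F => e.2.1) '' positiveTriples Γ F) = ⊤ := by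
  set D := AddSubgroup.closure ((fun e : F × (Fin d → ℤ) × F => e.2.1) '' positiveTriples Γ F)
  have hD : ∀ e ∈ crossingTriples (d := d) Γ F, e.2.1 ∈ D := by
    intro e he
    rw [crossingTriples_eq_union hΓ] at he
    rcases he with he | ⟨e, he, rfl⟩
    · exact AddSubgroup.subset_closure ⟨e, he, rfl⟩
    · exact D.neg_mem (AddSubgroup.subset_closure ⟨e, he, rfl⟩)
  -- The translates of `F` by elements of `D` are closed under adjacency, so by connectedness they
  -- exhaust the graph, and by freeness `D` is everything.
  have hstep : ∀ u w : V, Γ.Adj u w → (∃ g ∈ D, ∃ v : F, u = g +ᵥ (v : V)) →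
      ∃ g ∈ D, ∃ v : F, w = g +ᵥ (v : V) := by
    rintro u w hadj ⟨g, hg, v, rfl⟩
    obtain ⟨g', v', rfl⟩ := hF.fundamental.exists_vadd w
    refine ⟨g', ?_, v', rfl⟩
    by_cases h : g' = g
    · rwa [h]
    have h1 : (v, -g + g', v') ∈ crossingTriples Γ F := by
      refine ⟨fun h0 => h (neg_add_eq_zero.1 h0).symm, ?_⟩
      have := (hΓ.adj_vadd_iff (-g) _ _).2 hadj
      rwa [← add_vadd, ← add_vadd, neg_add_cancel, zero_vadd] at this
    have h2 := D.add_mem hg (hD _ h1)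
    simpa using h2
  obtain ⟨v₀, hv₀⟩ := hne
  have hall : ∀ w : V, ∃ g ∈ D, ∃ v : F, w = g +ᵥ (v : V) := by
    intro w
    obtain ⟨walk⟩ := hF.connected.preconnected v₀ w
    have : ∀ {u w : V}, Γ.Walk u w → (∃ g ∈ D, ∃ v : F, u = g +ᵥ (v : V)) →
        ∃ g ∈ D, ∃ v : F, w = g +ᵥ (v : V) := by
      intro u w walk
      induction walk with
      | nil => exact id
      | cons hadj _ ih => exact fun h => ih (hstep _ _ hadj h)
    exact this walk ⟨0, D.zero_mem, ⟨v₀, hv₀⟩, (zero_vadd _ _).symm⟩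
  rw [eq_top_iff]
  intro g _
  obtain ⟨g', hg', v, hv⟩ := hall (g +ᵥ v₀)
  have h1 : v₀ = v := hF.fundamental.eq_of_vadd_eq (g := -g + g') hv₀ v.2
    (by rw [add_vadd, ← hv, ← add_vadd, neg_add_cancel, zero_vadd])
  rw [← h1] at hv
  rwa [hΓ.eq_of_vadd_eq_vadd hF.connected hv]

end PeriodicGraph

/-! ### Edge phases as coordinates for the quasimomentum. -/

section Quasimomentum

variable {d : ℕ} {J : Type*}

/-- The phases `χ_α(c j) = e^{iθ_j}` as linear functions of the quasimomentum `α`. -/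
noncomputable def phaseMap (b : Module.Basis (Fin d) ℤ (Fin d → ℤ)) (c : J → (Fin d → ℤ)) :
    (Fin d → ℝ) →ₗ[ℝ] (J → ℝ) :=
  LinearMap.pi fun j => ∑ k, (b.repr (c j) k : ℝ) • LinearMap.proj k

theorem phaseMap_apply (b : Module.Basis (Fin d) ℤ (Fin d → ℤ)) (c : J → (Fin d → ℤ))
    (α : Fin d → ℝ) (j : J) : phaseMap b c α j = ∑ k, (b.repr (c j) k : ℝ) * α k := by
  simp [phaseMap, LinearMap.sum_apply]

theorem blochCharacter_eq_exp (b : Module.Basis (Fin d) ℤ (Fin d → ℤ)) (c : J → (Fin d → ℤ))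
    (α : Fin d → ℝ) (j : J) :
    blochCharacter b α (c j) = Complex.exp (phaseMap b c α j * Complex.I) := by
  rw [blochCharacter, phaseMap_apply, mul_comm]
  push_cast
  simp only [mul_comm]

/-- A quasimomentum defines a homomorphism `ψ` from `ℤ^d` to `ℝ`; if it vanishes on generators it
vanishes on the basis `b`, where its values are the coordinates of `α`. -/
theorem phaseMap_injective (b : Module.Basis (Fin d) ℤ (Fin d → ℤ)) {c : J → (Fin d → ℤ)}
    (hc : AddSubgroup.closure (Set.range c) = ⊤) : Function.Injective (phaseMap b c) := by
  rw [injective_iff_map_eq_zero]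
  intro α hα
  let ψ : (Fin d → ℤ) →+ ℝ :=
    { toFun := fun g => ∑ k, (b.repr g k : ℝ) * α k
      map_zero' := by simp
      map_add' := fun g g' => by simp [add_mul, Finset.sum_add_distrib] }
  have h1 : AddSubgroup.closure (Set.range c) ≤ ψ.ker := by
    rw [AddSubgroup.closure_le]
    rintro _ ⟨j, rfl⟩
    have := congrFun hα j
    rw [phaseMap_apply] at this
    exact this
  ext k
  have h2 : ψ (b k) = 0 := h1 (hc ▸ AddSubgroup.mem_top _)
  have h3 : ψ (b k) = α k := by
    change ∑ l, (b.repr (b k) l : ℝ) * α l = α k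
    rw [Finset.sum_eq_single k]
    · simp
    · intro l _ hl
      simp [hl.symm]
    · simp
  rw [← h3, h2, Pi.zero_apply]

/-- At a corner every phase is an integer multiple of `π`. -/
theorem exp_neg_phaseMap_eq_of_isCornerPoint (b : Module.Basis (Fin d) ℤ (Fin d → ℤ))
    (c : J → (Fin d → ℤ)) {α : Fin d → ℝ} (hα : IsCornerPoint α) (j : J) :
    Complex.exp (-(phaseMap b c α j * Complex.I)) = Complex.exp (phaseMap b c α j * Complex.I) := by
  choose m hm using hα
  have h1 : phaseMap b c α j = ((∑ k, b.repr (c j) k * m k : ℤ) : ℝ) * Real.pi := by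
    rw [phaseMap_apply]
    push_cast
    rw [Finset.sum_mul]
    exact Finset.sum_congr rfl fun k _ => by rw [hm k]; ring
  rw [h1, Complex.exp_eq_exp_iff_exists_int]
  refine ⟨-(∑ k, b.repr (c j) k * m k), ?_⟩
  push_cast
  ring

end Quasimomentum

/-! ### The Floquet–Bloch matrix as an edge pencil. -/

section FloquetBloch

variable {d : ℕ} {V : Type*} [AddAction (Fin d → ℤ) V] {Γ : SimpleGraph V} {F : Finset V}
  {H : Matrix V V ℂ}

theorem floquetBloch_apply_eq (hΓ : IsPeriodicGraph d Γ)
    (hF : HasOneCrossingEdgePerGenerator d Γ F) (hH : IsPeriodicSelfAdjoint d Γ H)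
    (b : Module.Basis (Fin d) ℤ (Fin d → ℤ)) (α : Fin d → ℝ)
    (hX : (crossingTriples (d := d) Γ F).Finite) (u v : F) :
    open Classical in
    floquetBloch b F H α u v = H u v + ∑ e ∈ hX.toFinset,
      if e.1 = u ∧ e.2.2 = v then H e.1 (e.2.1 +ᵥ (e.2.2 : V)) * blochCharacter b α e.2.1
      else 0 := by
  classical
  rw [← Finset.sum_filter]
  set X' := hX.toFinset.filter fun e => e.1 = u ∧ e.2.2 = v with hX'
  have hmem : ∀ e, e ∈ X' ↔ e ∈ crossingTriples Γ F ∧ e.1 = u ∧ e.2.2 = v := fun e => by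
    simp [hX']
  -- For `g ≠ 0` the vertex `g +ᵥ v` lies outside `F`, so a non-zero term comes from a crossing
  -- edge; `g = 0` gives the entry `H u v`.
  have hsupp : (Function.support fun g : Fin d → ℤ =>
      H u (g +ᵥ (v : V)) * blochCharacter b α g) ⊆ ↑(insert 0 (X'.image fun e => e.2.1)) := by
    intro g hg
    rw [Finset.coe_insert, Set.mem_insert_iff]
    by_cases hg0 : g = 0
    · exact Or.inl hg0
    refine Or.inr ?_
    have hne : (u : V) ≠ g +ᵥ (v : V) := fun h =>
      hg0 ((vadd_mem_iff_eq_zero hΓ hF v g).1 (h ▸ u.2))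
    have hadj := (hH.ne_zero_iff _ _ hne).1 (left_ne_zero_of_mul hg)
    exact Finset.mem_coe.2 (Finset.mem_image.2
      ⟨(u, g, v), (hmem _).2 ⟨⟨hg0, hadj⟩, rfl, rfl⟩, rfl⟩)
  rw [floquetBloch, Matrix.of_apply, finsum_eq_sum_of_support_subset _ hsupp,
    Finset.sum_insert, Finset.sum_image]
  · congr 1
    · simp [blochCharacter]
    · refine Finset.sum_congr rfl fun e he => ?_
      obtain ⟨-, h1, h2⟩ := (hmem e).1 he
      rw [h1, h2]
  · intro e he e' he' h
    obtain ⟨-, h1, h2⟩ := (hmem e).1 he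
    obtain ⟨-, h1', h2'⟩ := (hmem e').1 he'
    exact Prod.ext (h1.trans h1'.symm) (Prod.ext h (h2.trans h2'.symm))
  · intro h0
    obtain ⟨e, he, he0⟩ := Finset.mem_image.1 h0
    exact ((hmem e).1 he).1.1 he0

theorem finite_crossingTriples (hΓ : IsPeriodicGraph d Γ)
    (hF : HasOneCrossingEdgePerGenerator d Γ F) : (crossingTriples (d := d) Γ F).Finite := by
  rw [← Set.encard_ne_top_iff, encard_crossingTriples hΓ hF]
  exact (ENat.natCast_ne_top (2 * d))

/-- Summation over crossing edges, grouped into pairs of opposite orientations. -/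
theorem sum_crossingTriples (hΓ : IsPeriodicGraph d Γ)
    (hX : (crossingTriples (d := d) Γ F).Finite) [Fintype (positiveTriples (d := d) Γ F)]
    {e : positiveTriples (d := d) Γ F → F × (Fin d → ℤ) × F}
    (he : ∀ j, e j = j ∨ e j = reverseTriple j.1) (ψ : F × (Fin d → ℤ) × F → ℂ) :
    ∑ t ∈ hX.toFinset, ψ t = ∑ j, (ψ (e j) + ψ (reverseTriple (e j))) := by
  classical
  have hinj : Function.Injective (reverseTriple (d := d) (F := F)) :=
    Function.LeftInverse.injective reverseTriple_reverseTriple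
  have h1 : hX.toFinset = (positiveTriples (d := d) Γ F).toFinset ∪
      ((positiveTriples (d := d) Γ F).toFinset.image reverseTriple) := by
    ext t
    simp [crossingTriples_eq_union hΓ]
  have h2 : Disjoint (positiveTriples (d := d) Γ F).toFinset
      ((positiveTriples (d := d) Γ F).toFinset.image reverseTriple) := by
    rw [← Set.toFinset_image, Set.disjoint_toFinset]
    exact disjoint_positiveTriples
  rw [h1, Finset.sum_union h2, Finset.sum_image hinj.injOn, ← Finset.sum_add_distrib,
    ← Finset.sum_set_coe (positiveTriples (d := d) Γ F)
      (f := fun t => ψ t + ψ (reverseTriple t))]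
  refine Finset.sum_congr rfl fun j _ => ?_
  rcases he j with h | h
  · rw [h]
  · rw [h, reverseTriple_reverseTriple, add_comm]

/-- The Floquet–Bloch operator is an edge pencil in the phases of the crossing edges. -/
theorem toEuclideanLin_floquetBloch (hΓ : IsPeriodicGraph d Γ)
    (hF : HasOneCrossingEdgePerGenerator d Γ F) (hH : IsPeriodicSelfAdjoint d Γ H)
    (hreal : ∀ u v : V, (H u v).im = 0)
    (b : Module.Basis (Fin d) ℤ (Fin d → ℤ)) [Fintype (positiveTriples (d := d) Γ F)]
    {e : positiveTriples (d := d) Γ F → F × (Fin d → ℤ) × F}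
    (he : ∀ j, e j = j ∨ e j = reverseTriple j.1) (α : Fin d → ℝ) :
    open Classical in
    Matrix.toEuclideanLin (floquetBloch b F H α) =
      edgePencil (Matrix.toEuclideanLin (Matrix.of fun u v : F => H u v))
        (fun j => (H (e j).1 ((e j).2.1 +ᵥ ((e j).2.2 : V))).re)
        (fun j => EuclideanSpace.single (e j).1 1) (fun j => EuclideanSpace.single (e j).2.2 1)
        (phaseMap b (fun j => (e j).2.1) α) := by
  classical
  have hX := finite_crossingTriples hΓ hF
  ext x u
  rw [edgePencil_apply]
  have hh : ∀ j, ((H (e j).1 ((e j).2.1 +ᵥ ((e j).2.2 : V))).re : ℂ) =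
      H (e j).1 ((e j).2.1 +ᵥ ((e j).2.2 : V)) := fun j => Complex.ext rfl (hreal _ _).symm
  have hrev : ∀ j, H (e j).2.2 (-(e j).2.1 +ᵥ ((e j).1 : V)) =
      H (e j).1 ((e j).2.1 +ᵥ ((e j).2.2 : V)) := by
    intro j
    rw [← hH.periodic (e j).2.1, vadd_vadd, add_neg_cancel, zero_vadd, ← hH.hermitian.apply,
      ← hh j, Complex.star_def, Complex.conj_ofReal]
  have hchi : ∀ j, blochCharacter b α (-(e j).2.1) =
      Complex.exp (-(phaseMap b (fun j => (e j).2.1) α j * Complex.I)) := by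
    intro j
    rw [← star_blochCharacter, blochCharacter_eq_exp b (fun j => (e j).2.1) α j, Complex.star_def,
      conj_exp_mul_I]
  simp only [Matrix.toLpLin_apply, Matrix.mulVec, dotProduct, floquetBloch_apply_eq hΓ hF hH b α hX,
    sum_crossingTriples hΓ hX he, add_mul, Finset.sum_add_distrib, Finset.sum_mul,
    PiLp.add_apply, Matrix.of_apply, reverseTriple, hrev, hchi, WithLp.ofLp_sum, Finset.sum_apply,
    blochCharacter_eq_exp b (fun j => (e j).2.1) α, PiLp.smul_apply, EuclideanSpace.inner_single_left,
    hh, smul_eq_mul, map_one, one_mul]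
  have hsum : ∀ (s t : F) (z : ℂ), ∑ v, (if s = u ∧ t = v then z else 0) * x.ofLp v =
      z * x.ofLp t * (EuclideanSpace.single s (1 : ℂ)).ofLp u := by
    intro s t z
    rw [Finset.sum_eq_single t]
    · by_cases h : s = u
      · simp [h]
      · simp [h, Ne.symm h]
    · intro v _ hv
      simp [hv.symm]
    · simp
  have hswap : ∀ φ : F → positiveTriples (d := d) Γ F → ℂ,
      ∑ v, ∑ i, φ v i = ∑ i, ∑ v, φ v i := fun φ => Finset.sum_comm
  rw [hswap, hswap]
  simp only [hsum]
  rw [← Finset.sum_add_distrib]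
  congr 1
  exact Finset.sum_congr rfl fun j _ => by ring

end FloquetBloch

/-! ### Assembly of the theorem. -/

section Main

/-- Entrywise complex conjugation on Euclidean space. -/
noncomputable def euclideanConj (ι : Type*) [Fintype ι] :
    EuclideanSpace ℂ ι →ₛₗ[starRingEnd ℂ] EuclideanSpace ℂ ι where
  toFun x := WithLp.toLp 2 (star x.ofLp)
  map_add' x y := by ext; simp
  map_smul' c x := by ext; simp

theorem isTimeReversal_euclideanConj {ι J : Type*} [Fintype ι] [DecidableEq ι]
    {M : Matrix ι ι ℂ} (hM : ∀ i j, (M i j).im = 0) (s t : J → ι) :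
    IsTimeReversal (euclideanConj ι) (Matrix.toEuclideanLin M)
      (fun j => EuclideanSpace.single (s j) 1) (fun j => EuclideanSpace.single (t j) 1) where
  inner_map_map x y := by
    simp [euclideanConj, PiLp.inner_apply]
  map_op x := by
    ext i
    have : ∀ i j, conj (M i j) = M i j := fun i j => Complex.conj_eq_iff_im.2 (hM i j)
    simp [euclideanConj, Matrix.toLpLin_apply, Matrix.mulVec, dotProduct, this]
  map_left j := by
    ext i
    by_cases h : i = s j <;> simp [euclideanConj, h]
  map_right j := by
    ext i
    by_cases h : i = t j <;> simp [euclideanConj, h]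

/-- `le_of_isLocalMin`, with the phases of the edges expressed linearly by the quasimomentum. -/
theorem forall_le_of_isLocalMin {d : ℕ} {E : Type*} [NormedAddCommGroup E] [InnerProductSpace ℂ E]
    [FiniteDimensional ℂ E] {J : Type*} [Fintype J] (hJ : Fintype.card J = d)
    {C : E →ₛₗ[starRingEnd ℂ] E} {S : E →ₗ[ℂ] E} {h : J → ℝ} {a b : J → E}
    (β : (Fin d → ℝ) ≃ₗ[ℝ] (J → ℝ)) {φ : (Fin d → ℝ) → ℝ} {m q : ℕ} {f : E} {α₀ : Fin d → ℝ}
    (hC : IsTimeReversal C S a b) (hS : S.IsSymmetric) (hh : ∀ j, h j ≠ 0)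
    (hφ : ∀ α, IsMinimaxValue (edgePencil S h a b (β α)) (φ α) m q)
    (hf : ‖f‖ = 1) (hTf : edgePencil S h a b (β α₀) f = (φ α₀ : ℂ) • f)
    (hker : ∀ z, edgePencil S h a b (β α₀) z = (φ α₀ : ℂ) • z → ∃ c : ℂ, z = c • f)
    (haf : ∀ j, ⟪a j, f⟫_ℂ ≠ 0)
    (hcase : (∀ j, Complex.exp (-(β α₀ j * Complex.I)) = Complex.exp (β α₀ j * Complex.I)) ∨
      d ≤ 2 ∨ (d = 3 ∧ (hessianMatrix φ α₀).det ≠ 0))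
    (hmin : IsLocalMin φ α₀) (α : Fin d → ℝ) : φ α₀ ≤ φ α := by
  -- The pencil results live in phase coordinates, while the Hessian is taken in `α`; the linear
  -- isomorphism `β` carries local minimality one way and the quadratic bound back.
  let L : (J → ℝ) → ℝ := fun θ => φ (β.symm θ)
  have hLβ : ∀ α, L (β α) = φ α := fun α => by simp [L]
  have hL : ∀ θ, IsMinimaxValue (edgePencil S h a b θ) (L θ) m q := fun θ => by
    simpa [L] using hφ (β.symm θ)
  have hcont : Continuous β.symm := β.symm.toLinearMap.continuous_of_finiteDimensional
  have hLmin : IsLocalMin L (β α₀) := by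
    have h1 : Tendsto β.symm (𝓝 (β α₀)) (𝓝 α₀) := by
      simpa using hcont.tendsto (β α₀)
    have h2 := h1.eventually hmin
    filter_upwards [h2] with θ hθ
    rw [hLβ]
    exact hθ
  rw [← hLβ α₀, ← hLβ α]
  rw [← hLβ α₀] at hTf hker
  refine le_of_isLocalMin hC hS hh hL hf hTf hker haf hLmin ?_ _
  rcases hcase with h1 | h1 | ⟨h1, h2⟩
  · exact Or.inl h1
  · exact Or.inr (Or.inl (hJ ▸ h1))
  · refine Or.inr (Or.inr ⟨by omega, fun δ hδ hle => ?_⟩)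
    obtain ⟨K, hK⟩ := exists_le_add_mul_norm_sq_of_isLocalMin hS hh hL hf hker haf hLmin
    let βc : (Fin d → ℝ) →L[ℝ] (J → ℝ) := LinearMap.toContinuousLinearMap β.toLinearMap
    have hK' : ∀ y, φ y ≤ φ α₀ + (|K| * ‖βc‖ ^ 2) * ‖y - α₀‖ ^ 2 := by
      intro y
      have h3 := hK (β y)
      rw [hLβ, hLβ, ← map_sub] at h3
      have h4 : ‖β (y - α₀)‖ ≤ ‖βc‖ * ‖y - α₀‖ := βc.le_opNorm _
      have h5 : ‖β (y - α₀)‖ ^ 2 ≤ (‖βc‖ * ‖y - α₀‖) ^ 2 := by gcongr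
      have h6 : K * ‖β (y - α₀)‖ ^ 2 ≤ |K| * (‖βc‖ * ‖y - α₀‖) ^ 2 :=
        mul_le_mul (le_abs_self K) h5 (by positivity) (abs_nonneg K)
      linarith
    refine not_forall_eventually_le_of_det_hessianMatrix_ne_zero hmin hK' h2
      (η := β.symm δ) (by simpa using hδ) fun ε hε => ?_
    filter_upwards [hle ε hε] with t ht
    rw [hLβ] at ht
    simpa [L] using ht

theorem hessianMatrix_neg {d : ℕ} (φ : (Fin d → ℝ) → ℝ) (α : Fin d → ℝ) :
    hessianMatrix (fun α => -φ α) α = -hessianMatrix φ α := by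
  ext i j
  have : (fun α => -φ α) = -φ := rfl
  simp [hessianMatrix, this, iteratedFDeriv_neg_apply]

end Main

theorem theorem1p3 {d : ℕ} {V : Type*} [AddAction (Fin d → ℤ) V]
    (Γ : SimpleGraph V) (hΓ : IsPeriodicGraph d Γ)
    (F : Finset V) (hF : HasOneCrossingEdgePerGenerator d Γ F)
    (H : Matrix V V ℂ) (hH : IsPeriodicSelfAdjoint d Γ H)
    (hreal : ∀ u v : V, (H u v).im = 0)
    (b : Module.Basis (Fin d) ℤ (Fin d → ℤ))
    (n : Fin (Fintype.card F)) (α₀ : Fin d → ℝ)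
    (hsimple : Module.finrank ℂ (Module.End.eigenspace
      (Matrix.mulVecLin (floquetBloch b F H α₀)) (branch hH b F n α₀ : ℂ)) = 1)
    (f : F → ℂ) (hf : f ≠ 0)
    (hfeig : Matrix.mulVec (floquetBloch b F H α₀) f = (branch hH b F n α₀ : ℂ) • f)
    (hfcross : ∀ (u v : F) (g : Fin d → ℤ),
      g +ᵥ (v : V) ∉ F → Γ.Adj u (g +ᵥ (v : V)) → f u ≠ 0 ∨ f v ≠ 0)
    (hcase : IsCornerPoint α₀ ∨ d ≤ 2 ∨
      (d = 3 ∧ (hessianMatrix (branch hH b F n) α₀).det ≠ 0)) :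
    (IsLocalMin (branch hH b F n) α₀ →
      ∀ α : Fin d → ℝ, branch hH b F n α₀ ≤ branch hH b F n α) ∧
    (IsLocalMax (branch hH b F n) α₀ →
      ∀ α : Fin d → ℝ, branch hH b F n α ≤ branch hH b F n α₀) := by
  classical
  have hne : F.Nonempty := by
    have := n.pos
    rwa [Fintype.card_coe, Finset.card_pos] at this
  have hP : (positiveTriples (d := d) Γ F).Finite :=
    (finite_crossingTriples hΓ hF).subset fun e he => he.1
  let J := positiveTriples (d := d) Γ F
  let instJ : Fintype J := hP.fintype
  have hJ : Fintype.card J = d := by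
    have h1 := encard_positiveTriples hΓ hF
    rw [Set.encard_eq_coe_toFinset_card, Set.toFinset_card] at h1
    exact_mod_cast h1
  -- Each edge is oriented to start at an end where `f` does not vanish, so that the ratio across it
  -- can be formed.
  let e : J → F × (Fin d → ℤ) × F := fun j => if f j.1.1 ≠ 0 then j else reverseTriple j.1
  have he : ∀ j, e j = j ∨ e j = reverseTriple j.1 := fun j => by
    by_cases h : f j.1.1 ≠ 0
    · exact Or.inl (if_pos h)
    · exact Or.inr (if_neg h)
  have heX : ∀ j, e j ∈ crossingTriples Γ F := fun j => by
    rcases he j with h | h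
    · rw [h]; exact j.2.1
    · rw [h]; exact reverseTriple_mem hΓ j.2.1
  have hfe : ∀ j, f (e j).1 ≠ 0 := fun j => by
    by_cases h : f j.1.1 ≠ 0
    · simpa only [e, if_pos h] using h
    · simp only [e, if_neg h]
      refine (hfcross j.1.1 j.1.2.2 j.1.2.1 ?_ j.2.1.2).resolve_left h
      rw [vadd_mem_iff_eq_zero hΓ hF]
      exact j.2.1.1
  have hgen : AddSubgroup.closure (Set.range fun j => (e j).2.1) = ⊤ := by
    rw [eq_top_iff, ← closure_positiveTriples hΓ hF hne, AddSubgroup.closure_le]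
    rintro _ ⟨t, ht, rfl⟩
    have h1 : (e ⟨t, ht⟩).2.1 ∈ AddSubgroup.closure (Set.range fun j => (e j).2.1) :=
      AddSubgroup.subset_closure ⟨_, rfl⟩
    rcases he ⟨t, ht⟩ with h | h
    · rwa [h] at h1
    · rw [h] at h1
      exact neg_mem_iff.1 h1
  -- There are exactly `d` edges, so the injective phase map is bijective and the phases vary
  -- independently.
  let β : (Fin d → ℝ) ≃ₗ[ℝ] (J → ℝ) := LinearEquiv.ofInjectiveOfFinrankEq
    (phaseMap b fun j => (e j).2.1) (phaseMap_injective b hgen) (by simp [hJ])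
  let S : EuclideanSpace ℂ F →ₗ[ℂ] EuclideanSpace ℂ F :=
    Matrix.toEuclideanLin (Matrix.of fun u v : F => H u v)
  let h : J → ℝ := fun j => (H (e j).1 ((e j).2.1 +ᵥ ((e j).2.2 : V))).re
  let a : J → EuclideanSpace ℂ F := fun j => EuclideanSpace.single (e j).1 1
  let a' : J → EuclideanSpace ℂ F := fun j => EuclideanSpace.single (e j).2.2 1
  have hT : ∀ α, Matrix.toEuclideanLin (floquetBloch b F H α) = edgePencil S h a a' (β α) :=
    toEuclideanLin_floquetBloch hΓ hF hH hreal b he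
  have hC : IsTimeReversal (euclideanConj F) S a a' :=
    isTimeReversal_euclideanConj (M := Matrix.of fun u v : F => H u v) (fun u v => hreal u v) _ _
  have hS : S.IsSymmetric := Matrix.isSymmetric_toEuclideanLin_iff.2
    (by
      ext u v
      exact hH.hermitian.apply _ _)
  have hS' : (-S).IsSymmetric := fun x y => by
    rw [LinearMap.neg_apply, LinearMap.neg_apply, inner_neg_left, inner_neg_right, hS x y]
  have hh : ∀ j, h j ≠ 0 := fun j h0 => by
    have h1 : ((e j).1 : V) ≠ (e j).2.1 +ᵥ ((e j).2.2 : V) := (heX j).2.ne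
    exact (hH.ne_zero_iff _ _ h1).2 (heX j).2 (Complex.ext h0 (hreal _ _))
  -- `n.rev` turns the increasing numbering of branches into the decreasing one of the eigenvalues;
  -- `n.rev` of them are listed above the branch.
  have hφ : ∀ α, IsMinimaxValue (edgePencil S h a a' (β α)) (branch hH b F n α)
      (Fintype.card F - 1 - n.rev) n.rev := fun α => by
    rw [← hT]
    exact (Matrix.isSymmetric_toEuclideanLin_iff.2
      (floquetBloch_isHermitian hH b F α)).isMinimaxValue_eigenvalues finrank_euclideanSpace n.rev
  have heq : ∀ (l : ℂ) (z : EuclideanSpace ℂ F), edgePencil S h a a' (β α₀) z = l • z ↔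
      floquetBloch b F H α₀ *ᵥ z.ofLp = l • z.ofLp := fun l z => by
    rw [← hT, Matrix.toLpLin_apply]
    exact ⟨fun h => congrArg WithLp.ofLp h, fun h => congrArg (WithLp.toLp 2) h⟩
  let f₀ : EuclideanSpace ℂ F := WithLp.toLp 2 f
  have hf₀ : f₀ ≠ 0 := fun h0 => hf (congrArg WithLp.ofLp h0)
  have hnf : (‖f₀‖ : ℂ) ≠ 0 := by exact_mod_cast norm_ne_zero_iff.2 hf₀
  let f₁ : EuclideanSpace ℂ F := (‖f₀‖⁻¹ : ℂ) • f₀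
  have hf₁ : ‖f₁‖ = 1 := norm_smul_inv_norm hf₀
  have hTf : edgePencil S h a a' (β α₀) f₁ = (branch hH b F n α₀ : ℂ) • f₁ := by
    rw [map_smul, (heq _ f₀).2 hfeig, smul_comm]
  have hker : ∀ z, edgePencil S h a a' (β α₀) z = (branch hH b F n α₀ : ℂ) • z →
      ∃ c : ℂ, z = c • f₁ := by
    intro z hz
    obtain ⟨c, hc⟩ := (finrank_eq_one_iff_of_nonzero'
      (⟨f, Module.End.mem_eigenspace_iff.2 hfeig⟩ : Module.End.eigenspace
        (Matrix.mulVecLin (floquetBloch b F H α₀)) (branch hH b F n α₀ : ℂ))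
      (fun h0 => hf (congrArg Subtype.val h0))).1 hsimple
      ⟨z.ofLp, Module.End.mem_eigenspace_iff.2 ((heq _ z).1 hz)⟩
    have hc' : c • f = z.ofLp := congrArg Subtype.val hc
    refine ⟨c * ‖f₀‖, ?_⟩
    rw [smul_smul, mul_assoc, mul_inv_cancel₀ hnf, mul_one]
    exact (congrArg (WithLp.toLp 2) hc').symm
  have haf : ∀ j, ⟪a j, f₁⟫_ℂ ≠ 0 := fun j => by
    rw [inner_smul_right]
    refine mul_ne_zero (inv_ne_zero hnf) ?_
    rw [EuclideanSpace.inner_single_left, map_one, one_mul]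
    exact hfe j
  have hcase₁ : (∀ j, Complex.exp (-(β α₀ j * Complex.I)) = Complex.exp (β α₀ j * Complex.I)) ∨
      d ≤ 2 ∨ (d = 3 ∧ (hessianMatrix (branch hH b F n) α₀).det ≠ 0) :=
    hcase.imp_left fun hα => exp_neg_phaseMap_eq_of_isCornerPoint b _ hα
  -- For maxima the whole argument is applied to the negated pencil, which has the same form with
  -- `-S` and `-h`.
  have hneg : ∀ α, edgePencil (-S) (fun j => -h j) a a' (β α) = -edgePencil S h a a' (β α) :=
    fun α => (neg_edgePencil S h a a' (β α)).symm
  have hφ' : ∀ α, IsMinimaxValue (edgePencil (-S) (fun j => -h j) a a' (β α))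
      (-branch hH b F n α) n.rev (Fintype.card F - 1 - n.rev) := fun α => by
    rw [hneg]
    exact (hφ α).neg
  have hTf' : edgePencil (-S) (fun j => -h j) a a' (β α₀) f₁ =
      ((-branch hH b F n α₀ : ℝ) : ℂ) • f₁ := by
    rw [hneg, LinearMap.neg_apply, hTf, Complex.ofReal_neg, neg_smul]
  have hker' : ∀ z, edgePencil (-S) (fun j => -h j) a a' (β α₀) z =
      ((-branch hH b F n α₀ : ℝ) : ℂ) • z → ∃ c : ℂ, z = c • f₁ := fun z hz => by
    rw [hneg, LinearMap.neg_apply, Complex.ofReal_neg, neg_smul, neg_inj] at hz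
    exact hker z hz
  have hcase₂ : (∀ j, Complex.exp (-(β α₀ j * Complex.I)) = Complex.exp (β α₀ j * Complex.I)) ∨
      d ≤ 2 ∨ (d = 3 ∧ (hessianMatrix (fun α => -branch hH b F n α) α₀).det ≠ 0) := by
    refine hcase₁.imp_right (Or.imp_right (And.imp_right fun h0 => ?_))
    rw [hessianMatrix_neg, Matrix.det_neg]
    exact mul_ne_zero (pow_ne_zero _ (by norm_num)) h0
  exact ⟨fun hmin => forall_le_of_isLocalMin hJ β hC hS hh hφ hf₁ hTf hker haf hcase₁ hmin,
    fun hmax α => neg_le_neg_iff.1 (forall_le_of_isLocalMin hJ β hC.neg hS'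
      (fun j => neg_ne_zero.2 (hh j)) hφ' hf₁ hTf' hker' haf hcase₂ hmax.neg α)⟩
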